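/- Let $n\ge 1$, let $U\subset\mathbb R^n$ be open, connected and non-empty, and let $J,W\subset\mathbb R$ be non-empty open intervals. Let $g_{\alpha\beta}(x)$ be a smooth symmetric nondegenerate tensor (a metric of arbitrary signature) and $C^\alpha(x)$ a smooth vector field on $U$. Consider $$\Delta u-C^\alpha u_{,\alpha}-u_{,t}=0,\qquad \Delta=\frac1{\sqrt{|g|}}\,\partial_\alpha\!\left(\sqrt{|g|}\,g^{\alpha\beta}\partial_\beta\right).\tag{E}$$ A smooth vector field $X=\xi^t\partial_t+\xi^\alpha\partial_\alpha+\eta\,\partial_u$, with components functions of $(t,x,u)\in J\times U\times W$, is a Lie point symmetry of (E) if its second prolongation annihilates the left-hand side of (E) at every second-order jet at which that left-hand side vanishes. A smooth vector field $Y$ on $U$ is homothetic with factor $\psi\in\mathbb R$ if $L_Yg=2\psi g$; it is a Killing vector if $\psi=0$. The homothetic vector fields form the homothetic algebra of $g$. The homothetic algebra of $g$ on $U$ is finite-dimensional and has a basis whose members have factors in $\{0,1\}$. Moreover, let $Y_1,\dots,Y_d$ be any basis of it, with factors $\psi_1,\dots,\psi_d$, and let $t_0\in J$. Then $X$ is a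 Lie point symmetry of (E) if and only if there are constants $c_1,c_2\in\mathbb R$, smooth functions $T^1,\dots,T^d$ on $J$ and smooth functions $a(t,x)$, $b(t,x)$ on $J\times U$ such that on $J\times U\times W$ (summing over $I=1,\dots,d$) $$\xi^t=c_1+2\psi_I\int_{t_0}^tT^I(s)\,ds,\qquad \xi^\alpha=T^I(t)\,Y_I^\alpha(x),\qquad \eta=(a+c_2)u+b,$$ $a$ and $b$ are solutions of (E) on $J\times U$, and on $J\times U$ $$T^I L_{Y_I}C_\alpha-T^I_{,t}\,Y_{I\alpha}-2a_{,\alpha}=0,$$ where $C_\alpha=g_{\alpha\beta}C^\beta$ and $Y_{I\alpha}=g_{\alpha\beta}Y_I^\beta$. -/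

import Mathlib

open scoped ContDiff

namespace PointSymmetry

noncomputable section

/-! ### Point vector fields on jet space and their second prolongation -/

/-- Points `(x, u)`: independent variables indexed by `ι`, and the dependent variable. -/
abbrev Jet0 (ι : Type) : Type := (ι → ℝ) × ℝ

/-- Points `(x, u, u_i)` of the first jet space. -/
abbrev Jet1 (ι : Type) : Type := (ι → ℝ) × ℝ × (ι → ℝ)

/-- Points `(x, u, u_i, u_ij)` of the second jet space; genuine jets have `u_ij = u_ji`. -/
abbrev Jet2 (ι : Type) : Type := (ι → ℝ) × ℝ × (ι → ℝ) × (ι → ι → ℝ)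

/-- A vector field `ξ^i(x,u) ∂_i + η(x,u) ∂_u` on the space of `(x, u)`. -/
structure PointField (ι : Type) where
  ξ : ι → Jet0 ι → ℝ
  η : Jet0 ι → ℝ

/-- Smoothness of all components on a domain. -/
def PointField.SmoothOn {ι : Type} [Fintype ι] (X : PointField ι) (Ω : Set (Jet0 ι)) : Prop :=
  (∀ i, ContDiffOn ℝ ∞ (X.ξ i) Ω) ∧ ContDiffOn ℝ ∞ X.η Ω

section Prolongation

variable {ι : Type} [Fintype ι] [DecidableEq ι]

/-- Total derivative of a function of `(x, u)`: `D_i F = F_{,i} + u_i F_{,u}`. -/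
def totalDeriv0 (i : ι) (F : Jet0 ι → ℝ) (j : Jet1 ι) : ℝ :=
  fderiv ℝ F (j.1, j.2.1) (Pi.single i 1, j.2.2 i)

/-- Total derivative of a function of `(x, u, u_k)`:
`D_i F = F_{,i} + u_i F_{,u} + u_ik ∂F/∂u_k`. -/
def totalDeriv1 (i : ι) (F : Jet1 ι → ℝ) (j : Jet2 ι) : ℝ :=
  fderiv ℝ F (j.1, j.2.1, j.2.2.1) (Pi.single i 1, j.2.2.1 i, j.2.2.2 i)

/-- `η_i = D_i η - u_k D_i ξ^k`. -/
def PointField.eta1 (X : PointField ι) (i : ι) (j : Jet1 ι) : ℝ :=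
  totalDeriv0 i X.η j - ∑ k, j.2.2 k * totalDeriv0 i (X.ξ k) j

/-- `η_ij = D_j η_i - u_ki D_j ξ^k`. -/
def PointField.eta2 (X : PointField ι) (i j : ι) (q : Jet2 ι) : ℝ :=
  totalDeriv1 j (X.eta1 i) q
    - ∑ k, q.2.2.2 k i * totalDeriv0 j (X.ξ k) (q.1, q.2.1, q.2.2.1)

/-- The second prolongation `X + η_i ∂_{u_i} + η_ij ∂_{u_ij}`, as a vector field on the
second jet space. -/
def PointField.prolong (X : PointField ι) (q : Jet2 ι) : Jet2 ι :=
  (fun i => X.ξ i (q.1, q.2.1), X.η (q.1, q.2.1),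
    fun i => X.eta1 i (q.1, q.2.1, q.2.2.1), fun i j => X.eta2 i j q)

/-- `X` is a Lie point symmetry of `Θ = 0` over the domain `Ω` of the `(x, u)`-space: the
Lie derivative of `Θ` along the second prolongation of `X` vanishes at each second-order
jet over `Ω` at which `Θ` vanishes. -/
def IsLiePointSymmetry (Θ : Jet2 ι → ℝ) (Ω : Set (Jet0 ι)) (X : PointField ι) : Prop :=
  ∀ (x : ι → ℝ) (u : ℝ) (p : ι → ℝ) (r : ι → ι → ℝ), (x, u) ∈ Ω → (∀ i j, r i j = r j i) →
    Θ (x, u, p, r) = 0 → fderiv ℝ Θ (x, u, p, r) (X.prolong (x, u, p, r)) = 0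

end Prolongation

/-! ### Metrics, homothetic vectors, Laplace operator, in coordinates `x^α` -/

section Metric

variable {n : ℕ}

/-- Partial derivative `∂f/∂x^α`. -/
def pd (α : Fin n) (f : (Fin n → ℝ) → ℝ) (x : Fin n → ℝ) : ℝ :=
  fderiv ℝ f x (Pi.single α 1)

/-- `g` is a smooth (pseudo-)Riemannian metric on `U`, of any signature. -/
structure IsMetricOn (U : Set (Fin n → ℝ))
    (g : (Fin n → ℝ) → Matrix (Fin n) (Fin n) ℝ) : Prop where
  smooth : ∀ α β, ContDiffOn ℝ ∞ (fun x => g x α β) U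
  symm : ∀ x ∈ U, (g x).IsSymm
  nondegenerate : ∀ x ∈ U, (g x).det ≠ 0

/-- Lie derivative of the metric:
`(L_Y g)_{αβ} = Y^γ g_{αβ,γ} + g_{γβ} Y^γ_{,α} + g_{αγ} Y^γ_{,β}`. -/
def lieMetric (Y : (Fin n → ℝ) → Fin n → ℝ) (g : (Fin n → ℝ) → Matrix (Fin n) (Fin n) ℝ)
    (x : Fin n → ℝ) (α β : Fin n) : ℝ :=
  ∑ γ, (Y x γ * pd γ (fun y => g y α β) x
    + g x γ β * pd α (fun y => Y y γ) x + g x α γ * pd β (fun y => Y y γ) x)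

/-- Lie derivative of a covector field: `(L_Y w)_α = Y^γ w_{α,γ} + w_γ Y^γ_{,α}`. -/
def lieCovector (Y w : (Fin n → ℝ) → Fin n → ℝ) (x : Fin n → ℝ) (α : Fin n) : ℝ :=
  ∑ γ, (Y x γ * pd γ (fun y => w y α) x + w x γ * pd α (fun y => Y y γ) x)

/-- Lowering the index of a vector field: `V_α = g_{αβ} V^β`. -/
def lower (g : (Fin n → ℝ) → Matrix (Fin n) (Fin n) ℝ) (V : (Fin n → ℝ) → Fin n → ℝ)
    (x : Fin n → ℝ) (α : Fin n) : ℝ :=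
  ∑ β, g x α β * V x β

/-- `Y` is a smooth homothetic vector field of `g` on `U` with constant homothetic factor
`ψ`, i.e. `L_Y g = 2 ψ g`; it is a Killing vector field when `ψ = 0`. -/
structure IsHomotheticOn (U : Set (Fin n → ℝ)) (g : (Fin n → ℝ) → Matrix (Fin n) (Fin n) ℝ)
    (Y : (Fin n → ℝ) → Fin n → ℝ) (ψ : ℝ) : Prop where
  smooth : ContDiffOn ℝ ∞ Y U
  lie_eq : ∀ x ∈ U, ∀ α β, lieMetric Y g x α β = 2 * ψ * g x α β

/-- `Y_1, …, Y_d`, with homothetic factors `ψ_1, …, ψ_d`, form a basis of the homothetic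
algebra of `g` on `U` (fields being identified when they agree on `U`). -/
structure IsHomotheticBasis (U : Set (Fin n → ℝ))
    (g : (Fin n → ℝ) → Matrix (Fin n) (Fin n) ℝ) {d : ℕ}
    (Y : Fin d → (Fin n → ℝ) → Fin n → ℝ) (ψ : Fin d → ℝ) : Prop where
  homothetic : ∀ I, IsHomotheticOn U g (Y I) (ψ I)
  linearIndependent : LinearIndependent ℝ (fun I => U.domRestrict (Y I))
  spanning : ∀ (Z : (Fin n → ℝ) → Fin n → ℝ) (χ : ℝ), IsHomotheticOn U g Z χ →
    ∃ c : Fin d → ℝ, ∀ x ∈ U, Z x = ∑ I, c I • Y I x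

/-- `√|g|`, with `|g|` the absolute value of the determinant of the metric. -/
def sqrtDet (g : (Fin n → ℝ) → Matrix (Fin n) (Fin n) ℝ) (x : Fin n → ℝ) : ℝ :=
  Real.sqrt |(g x).det|

/-- The Laplace operator `Δf = (1/√|g|) ∂_α (√|g| g^{αβ} ∂_β f)`. -/
def laplacian (g : (Fin n → ℝ) → Matrix (Fin n) (Fin n) ℝ) (f : (Fin n → ℝ) → ℝ)
    (x : Fin n → ℝ) : ℝ :=
  (sqrtDet g x)⁻¹ *
    ∑ α, pd α (fun y => ∑ β, sqrtDet g y * (g y)⁻¹ α β * pd β f y) x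

/-- The coefficient `(1/√|g|) ∂_α (√|g| g^{αβ})` of `f_{,β}` in `Δf`. -/
def laplacianDrift (g : (Fin n → ℝ) → Matrix (Fin n) (Fin n) ℝ) (x : Fin n → ℝ)
    (β : Fin n) : ℝ :=
  (sqrtDet g x)⁻¹ * ∑ α, pd α (fun y => sqrtDet g y * (g y)⁻¹ α β) x

/-! ### The evolution equation `Δu - C^α u_{,α} - u_{,t} = 0`

The independent variables are indexed by `Option (Fin n)`: `none` is the time `t` and
`some α` is `x^α`. -/

/-- The space coordinates of a point `(t, x)`. -/
def space (z : Option (Fin n) → ℝ) : Fin n → ℝ := fun α => z (some α)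

/-- The evolution equation as a function on the second jet space:
`Θ = g^{αβ} u_{,αβ} + (1/√|g|) (√|g| g^{αβ})_{,α} u_{,β} - C^α u_{,α} - u_{,t}`. -/
def evolutionTheta (g : (Fin n → ℝ) → Matrix (Fin n) (Fin n) ℝ) (C : (Fin n → ℝ) → Fin n → ℝ)
    (q : Jet2 (Option (Fin n))) : ℝ :=
  ∑ α, ∑ β, (g (space q.1))⁻¹ α β * q.2.2.2 (some α) (some β)
    + ∑ β, laplacianDrift g (space q.1) β * q.2.2.1 (some β)
    - ∑ α, C (space q.1) α * q.2.2.1 (some α) - q.2.2.1 none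

/-- `v = v(t, x)` is a smooth solution of `Δv - C^α v_{,α} - v_{,t} = 0` on `J × U`. -/
structure IsSolutionOn (J : Set ℝ) (U : Set (Fin n → ℝ))
    (g : (Fin n → ℝ) → Matrix (Fin n) (Fin n) ℝ) (C : (Fin n → ℝ) → Fin n → ℝ)
    (v : ℝ → (Fin n → ℝ) → ℝ) : Prop where
  smooth : ContDiffOn ℝ ∞ (fun q : ℝ × (Fin n → ℝ) => v q.1 q.2) (J ×ˢ U)
  eq_zero : ∀ t ∈ J, ∀ x ∈ U,
    laplacian g (v t) x - ∑ α, C x α * pd α (v t) x - deriv (fun s => v s x) t = 0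

/-- The domain `t ∈ J`, `x ∈ U`, `u ∈ W` of the `(t, x, u)`-space. -/
def domain (J : Set ℝ) (U : Set (Fin n → ℝ)) (W : Set ℝ) : Set (Jet0 (Option (Fin n))) :=
  {q | q.1 none ∈ J ∧ space q.1 ∈ U ∧ q.2 ∈ W}

lemma IsMetricOn.contDiffOn_det {U : Set (Fin n → ℝ)}
    {g : (Fin n → ℝ) → Matrix (Fin n) (Fin n) ℝ} (hg : IsMetricOn U g) :
    ContDiffOn ℝ ∞ (fun x => (g x).det) U := by
  simp only [Matrix.det_apply]
  refine ContDiffOn.sum fun σ _ => ContDiffOn.const_smul _ ?_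
  exact contDiffOn_prod fun i _ => hg.smooth _ _

lemma IsMetricOn.contDiffOn_inv {U : Set (Fin n → ℝ)}
    {g : (Fin n → ℝ) → Matrix (Fin n) (Fin n) ℝ} (hg : IsMetricOn U g) (α β : Fin n) :
    ContDiffOn ℝ ∞ (fun x => (g x)⁻¹ α β) U := by
  have h : ContDiffOn ℝ ∞ (fun x => ((g x).det)⁻¹ * (g x).adjugate α β) U := by
    refine (hg.contDiffOn_det.inv hg.nondegenerate).mul ?_
    simp only [Matrix.adjugate_apply, Matrix.det_apply]
    refine ContDiffOn.sum fun σ _ => ContDiffOn.const_smul _ ?_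
    refine contDiffOn_prod fun i _ => ?_
    by_cases hi : σ i = β
    · simp only [hi, Matrix.updateRow_self]
      exact contDiffOn_const
    · simp only [Matrix.updateRow_ne hi]
      exact hg.smooth _ _
  refine h.congr fun x _ => ?_
  simp [Matrix.inv_def, Ring.inverse_eq_inv']

lemma IsMetricOn.contDiffOn_sqrtDet {U : Set (Fin n → ℝ)}
    {g : (Fin n → ℝ) → Matrix (Fin n) (Fin n) ℝ} (hg : IsMetricOn U g) :
    ContDiffOn ℝ ∞ (sqrtDet g) U := by
  have h : ContDiffOn ℝ ∞ (fun x => |(g x).det|) U := fun x hx =>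
    ContDiffAt.comp_contDiffWithinAt (g := fun y : ℝ => |y|) x
      (contDiffAt_abs (hg.nondegenerate x hx)) (hg.contDiffOn_det x hx)
  exact h.sqrt fun x hx => abs_ne_zero.mpr (hg.nondegenerate x hx)

/-- The Laplace operator written out in first and second derivatives; this is why
`evolutionTheta` is the equation `Δu - C^α u_{,α} - u_{,t} = 0`. -/
lemma laplacian_eq {U : Set (Fin n → ℝ)} (hU : IsOpen U)
    {g : (Fin n → ℝ) → Matrix (Fin n) (Fin n) ℝ} (hg : IsMetricOn U g)
    {f : (Fin n → ℝ) → ℝ} (hf : ContDiffOn ℝ ∞ f U) {x : Fin n → ℝ} (hx : x ∈ U) :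
    laplacian g f x = ∑ α, ∑ β, (g x)⁻¹ α β * pd α (pd β f) x
      + ∑ β, laplacianDrift g x β * pd β f x := by
  have hs : sqrtDet g x ≠ 0 := by
    unfold sqrtDet
    exact (Real.sqrt_pos.mpr (abs_pos.mpr (hg.nondegenerate x hx))).ne'
  have hA : ∀ α β, DifferentiableAt ℝ (fun y => sqrtDet g y * (g y)⁻¹ α β) x := fun α β =>
    ((hg.contDiffOn_sqrtDet.mul (hg.contDiffOn_inv α β)).contDiffAt
      (hU.mem_nhds hx)).differentiableAt (by simp)
  have hB : ∀ β, DifferentiableAt ℝ (pd β f) x := fun β => by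
    have h1 : ContDiffAt ℝ 1 (fderiv ℝ f) x :=
      (hf.contDiffAt (hU.mem_nhds hx)).fderiv_right (by norm_cast)
    exact (h1.differentiableAt (by simp)).clm_apply (differentiableAt_const _)
  have key : ∀ α, pd α (fun y => ∑ β, sqrtDet g y * (g y)⁻¹ α β * pd β f y) x
      = ∑ β, (sqrtDet g x * (g x)⁻¹ α β * pd α (pd β f) x
        + pd β f x * pd α (fun y => sqrtDet g y * (g y)⁻¹ α β) x) := by
    intro α
    have h := HasFDerivAt.fun_sum (u := Finset.univ) fun β _ =>
      (hA α β).hasFDerivAt.fun_mul (hB β).hasFDerivAt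
    have h2 : pd α (fun y => ∑ β, sqrtDet g y * (g y)⁻¹ α β * pd β f y) x = _ :=
      congrArg (fun L => L (Pi.single α 1)) h.fderiv
    rw [h2, sum_apply]
    refine Finset.sum_congr rfl fun β _ => ?_
    simp [pd, smul_eq_mul]
  unfold laplacian laplacianDrift
  simp only [key, Finset.sum_add_distrib, mul_add]
  congr 1
  · rw [Finset.mul_sum]
    refine Finset.sum_congr rfl fun α _ => ?_
    rw [Finset.mul_sum]
    refine Finset.sum_congr rfl fun β _ => ?_
    field_simp
  · rw [Finset.sum_comm, Finset.mul_sum]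
    refine Finset.sum_congr rfl fun β _ => ?_
    rw [← Finset.mul_sum]
    ring

end Metric

end

end PointSymmetry

open PointSymmetry

/-! On the equation the jet coordinate `u_t` is a function of the others, while `u_{,α}`, the
symmetric `u_{,αβ}` and the second derivatives involving `t` stay free. The symmetry condition is
thus a polynomial identity in free coordinates, and comparing coefficients leaves equations on `X`
alone (`DeterminingEquations`). The terms in `u_{,tα}` force `ξ^t` to depend on `t` only
(`IsLiePointSymmetry.time_component`). The terms in `u_{,αβ}` force `ξ^α` to be independent of `u`
and, at each `t`, homothetic in `x` with factor `½ ξ^t_{,t}` (`symbolCond_eq_zero_iff`). The rest is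
quadratic in `u_{,α}`: degree two gives `η_{,uu} = 0`, degree zero says that `η` solves (E) at each
fixed `u`, and degree one is an equation whose metric terms cancel because a homothetic field
rescales the Laplace operator by a constant (`IsHomotheticOn.apply_laplacianDrift`); lowering its
index gives the equation that couples `T^I`, `C_α` and `a`. These equations are also sufficient
(`isLiePointSymmetry_of_determining`).

Finite dimension: the differentiated Killing equation, permuted cyclically, bounds the second
derivatives of a Killing field by its first jet. A first jet that vanishes at a point therefore
satisfies a linear differential inequality along segments, so it vanishes nearby and, by
connectedness, on `U`. A homothetic field with zero first jet at a point is Killing, so evaluating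
the first jet at one point is injective on the homothetic algebra.

Assembly: at each `t` the spatial part of `X` is a combination `T^I Y_I`. The `T^I` are fixed finite
combinations of values of `ξ^α` (`exists_dual_evaluations`), hence smooth in `t`. Comparing
homothetic factors gives `ξ^t_{,t} = 2 ψ_I T^I`, which is integrated from `t₀`. Finally `η` is
affine in `u`, and its slope `a` is a difference quotient of two solutions, hence a solution. -/

namespace PointSymmetry

/-! ### Directional derivatives and Jacobi's formula. -/

section Calculus

variable {E : Type*} [NormedAddCommGroup E] [NormedSpace ℝ E]

/-- The derivative of a real function in a fixed direction. -/
noncomputable def dirDeriv (v : E) (f : E → ℝ) (x : E) : ℝ := fderiv ℝ f x v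

lemma differentiableAt_of_contDiffOn {F : Type*} [NormedAddCommGroup F] [NormedSpace ℝ F]
    {s : Set E} (hs : IsOpen s) {f : E → F}
    (hf : ContDiffOn ℝ ∞ f s) {x : E} (hx : x ∈ s) : DifferentiableAt ℝ f x :=
  (hf.contDiffAt (hs.mem_nhds hx)).differentiableAt (by simp)

lemma contDiffOn_dirDeriv {s : Set E} (hs : IsOpen s) {f : E → ℝ} (hf : ContDiffOn ℝ ∞ f s)
    (v : E) : ContDiffOn ℝ ∞ (dirDeriv v f) s :=
  (hf.fderiv_of_isOpen hs (m := ∞) (by simp)).clm_apply contDiffOn_const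

lemma dirDeriv_comm {s : Set E} (hs : IsOpen s) {f : E → ℝ} (hf : ContDiffOn ℝ ∞ f s)
    (v w : E) {x : E} (hx : x ∈ s) :
    dirDeriv v (dirDeriv w f) x = dirDeriv w (dirDeriv v f) x := by
  have hc := hf.contDiffAt (hs.mem_nhds hx)
  have hd : DifferentiableAt ℝ (fderiv ℝ f) x :=
    differentiableAt_of_contDiffOn hs (hf.fderiv_of_isOpen hs (m := ∞) (by simp)) hx
  have key : ∀ a b : E, dirDeriv a (dirDeriv b f) x = fderiv ℝ (fderiv ℝ f) x a b := by
    intro a b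
    have h := (hd.hasFDerivAt.clm_apply (hasFDerivAt_const b x)).fderiv
    unfold dirDeriv
    rw [h]
    simp
  rw [key, key]
  exact (hc.isSymmSndFDerivAt (by simp only [minSmoothness_of_isRCLikeNormedField]; norm_cast)).eq v w

lemma dirDeriv_congr {s : Set E} (hs : IsOpen s) {f g : E → ℝ} (h : Set.EqOn f g s)
    (v : E) {x : E} (hx : x ∈ s) : dirDeriv v f x = dirDeriv v g x := by
  have : f =ᶠ[nhds x] g := Filter.eventuallyEq_of_mem (hs.mem_nhds hx) h
  unfold dirDeriv
  rw [this.fderiv_eq]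

@[simp]
lemma dirDeriv_const (v : E) (c : ℝ) (x : E) : dirDeriv v (fun _ => c) x = 0 := by
  simp [dirDeriv]

lemma dirDeriv_add {f g : E → ℝ} {x : E} (hf : DifferentiableAt ℝ f x)
    (hg : DifferentiableAt ℝ g x) (v : E) :
    dirDeriv v (fun y => f y + g y) x = dirDeriv v f x + dirDeriv v g x := by
  unfold dirDeriv
  rw [fderiv_fun_add hf hg]
  rfl

lemma dirDeriv_sub {f g : E → ℝ} {x : E} (hf : DifferentiableAt ℝ f x)
    (hg : DifferentiableAt ℝ g x) (v : E) :
    dirDeriv v (fun y => f y - g y) x = dirDeriv v f x - dirDeriv v g x := by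
  unfold dirDeriv
  rw [fderiv_fun_sub hf hg]
  rfl

lemma dirDeriv_mul {f g : E → ℝ} {x : E} (hf : DifferentiableAt ℝ f x)
    (hg : DifferentiableAt ℝ g x) (v : E) :
    dirDeriv v (fun y => f y * g y) x = dirDeriv v f x * g x + f x * dirDeriv v g x := by
  unfold dirDeriv
  rw [fderiv_fun_mul hf hg]
  simp [smul_eq_mul]
  ring

lemma dirDeriv_const_mul {f : E → ℝ} {x : E} (hf : DifferentiableAt ℝ f x) (c : ℝ) (v : E) :
    dirDeriv v (fun y => c * f y) x = c * dirDeriv v f x := by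
  rw [dirDeriv_mul (differentiableAt_const c) hf]
  simp

lemma dirDeriv_sum {κ : Type*} {u : Finset κ} {f : κ → E → ℝ} {x : E}
    (hf : ∀ i ∈ u, DifferentiableAt ℝ (f i) x) (v : E) :
    dirDeriv v (fun y => ∑ i ∈ u, f i y) x = ∑ i ∈ u, dirDeriv v (f i) x := by
  unfold dirDeriv
  rw [fderiv_fun_sum hf]
  simp

lemma dirDeriv_pi_eq_sum {κ : Type*} [Fintype κ] [DecidableEq κ] (f : (κ → ℝ) → ℝ) (x v : κ → ℝ) :
    fderiv ℝ f x v = ∑ i, v i * dirDeriv (Pi.single i 1) f x := by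
  conv_lhs => rw [pi_eq_sum_univ' v]
  simp [dirDeriv]

/-- Jacobi's formula for the derivative of a determinant. -/
lemma dirDeriv_det {m : Type*} [Fintype m] [DecidableEq m] {M : E → Matrix m m ℝ} {x : E}
    (hM : ∀ i j, DifferentiableAt ℝ (fun y => M y i j) x) (v : E) :
    dirDeriv v (fun y => (M y).det) x
      = ((M x).adjugate * Matrix.of fun i j => dirDeriv v (fun y => M y i j) x).trace := by
  let D : ContinuousMultilinearMap ℝ (fun _ : m => m → ℝ) ℝ :=
    { (Matrix.detRowAlternating (n := m) (R := ℝ)).toMultilinearMap with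
      cont := Continuous.matrix_det (A := fun N : Matrix m m ℝ => N) continuous_id }
  have hrow : HasFDerivAt (fun y i j => M y i j)
      (ContinuousLinearMap.pi fun i => ContinuousLinearMap.pi fun j =>
        fderiv ℝ (fun y => M y i j) x) x :=
    hasFDerivAt_pi.2 fun i => hasFDerivAt_pi.2 fun j => (hM i j).hasFDerivAt
  have h := ((D.hasFDerivAt (M x)).comp x hrow).fderiv
  have h2 : dirDeriv v (fun y => (M y).det) x = _ := congrArg (fun L => L v) h
  rw [h2]
  change D.linearDeriv (M x) (fun i j => dirDeriv v (fun y => M y i j) x) = _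
  refine (ContinuousMultilinearMap.linearDeriv_apply D (M x) _).trans ?_
  rw [Matrix.trace_mul_comm, Matrix.trace]
  refine Finset.sum_congr rfl fun i _ => ?_
  have h3 : ∀ b : m → ℝ, D (Function.update (M x) i b) = ((M x).updateRow i b).det := fun b => rfl
  -- The derivative of the multilinear determinant is a sum of determinants with one row replaced;
  -- Cramer's rule turns each into a row of the adjugate product.
  rw [h3, ← Matrix.cramer_transpose_apply, Matrix.cramer_eq_adjugate_mulVec,
    ← Matrix.adjugate_transpose, Matrix.diag_apply, Matrix.mul_apply]
  simp only [Matrix.mulVec, dotProduct, Matrix.transpose_apply, Matrix.of_apply]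
  exact Finset.sum_congr rfl fun j _ => mul_comm _ _

end Calculus

/-! ### Homothetic fields acting on the inverse metric, the volume density and the Laplace drift. -/

section Geometry

variable {n : ℕ} {U : Set (Fin n → ℝ)} {g : (Fin n → ℝ) → Matrix (Fin n) (Fin n) ℝ}

lemma pd_eq_dirDeriv (α : Fin n) (f : (Fin n → ℝ) → ℝ) : pd α f = dirDeriv (Pi.single α 1) f := rfl

lemma contDiffOn_pd (hU : IsOpen U) {f : (Fin n → ℝ) → ℝ} (hf : ContDiffOn ℝ ∞ f U) (α : Fin n) :
    ContDiffOn ℝ ∞ (pd α f) U := contDiffOn_dirDeriv hU hf _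

lemma contDiffOn_component {Y : (Fin n → ℝ) → Fin n → ℝ} (hY : ContDiffOn ℝ ∞ Y U) (γ : Fin n) :
    ContDiffOn ℝ ∞ (fun y => Y y γ) U := contDiffOn_pi.1 hY γ

/-- The logarithm of `√|g|`. -/
noncomputable def logSqrtDet (g : (Fin n → ℝ) → Matrix (Fin n) (Fin n) ℝ) (x : Fin n → ℝ) : ℝ :=
  1 / 2 * Real.log (g x).det

lemma contDiffOn_logSqrtDet (hg : IsMetricOn U g) : ContDiffOn ℝ ∞ (logSqrtDet g) U :=
  contDiffOn_const.mul (hg.contDiffOn_det.log hg.nondegenerate)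

lemma sqrtDet_eq_exp (hg : IsMetricOn U g) {x : Fin n → ℝ} (hx : x ∈ U) :
    sqrtDet g x = Real.exp (logSqrtDet g x) := by
  unfold sqrtDet logSqrtDet
  -- `Real.log` ignores the sign of its argument, so `logSqrtDet` needs no absolute value and serves
  -- every signature.
  rw [← Real.log_abs, Real.sqrt_eq_rpow, Real.rpow_def_of_pos (abs_pos.2 (hg.nondegenerate x hx)),
    mul_comm]

lemma sqrtDet_ne_zero (hg : IsMetricOn U g) {x : Fin n → ℝ} (hx : x ∈ U) : sqrtDet g x ≠ 0 := by
  rw [sqrtDet_eq_exp hg hx]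
  exact (Real.exp_pos _).ne'

lemma pd_sqrtDet (hU : IsOpen U) (hg : IsMetricOn U g) {x : Fin n → ℝ} (hx : x ∈ U) (α : Fin n) :
    pd α (sqrtDet g) x = sqrtDet g x * pd α (logSqrtDet g) x := by
  have hd := differentiableAt_of_contDiffOn hU (contDiffOn_logSqrtDet hg) hx
  rw [pd_eq_dirDeriv, dirDeriv_congr hU (fun y hy => sqrtDet_eq_exp hg hy) _ hx,
    sqrtDet_eq_exp hg hx, dirDeriv, hd.hasFDerivAt.exp.fderiv]
  rfl

lemma laplacianDrift_eq (hU : IsOpen U) (hg : IsMetricOn U g) {x : Fin n → ℝ} (hx : x ∈ U)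
    (β : Fin n) :
    laplacianDrift g x β = ∑ α, (pd α (fun y => (g y)⁻¹ α β) x
      + (g x)⁻¹ α β * pd α (logSqrtDet g) x) := by
  have hs := sqrtDet_ne_zero hg hx
  unfold laplacianDrift
  rw [Finset.mul_sum]
  refine Finset.sum_congr rfl fun α _ => ?_
  have h : pd α (fun y => sqrtDet g y * (g y)⁻¹ α β) x = _ :=
    dirDeriv_mul (differentiableAt_of_contDiffOn hU hg.contDiffOn_sqrtDet hx)
      (differentiableAt_of_contDiffOn hU (hg.contDiffOn_inv α β) hx) _
  rw [h, ← pd_eq_dirDeriv, ← pd_eq_dirDeriv, pd_sqrtDet hU hg hx]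
  field_simp
  ring

lemma contDiffOn_laplacianDrift (hU : IsOpen U) (hg : IsMetricOn U g) (β : Fin n) :
    ContDiffOn ℝ ∞ (fun x => laplacianDrift g x β) U := by
  have h : ContDiffOn ℝ ∞ (fun x => ∑ α, (pd α (fun y => (g y)⁻¹ α β) x
      + (g x)⁻¹ α β * pd α (logSqrtDet g) x)) U :=
    ContDiffOn.sum fun α _ => (contDiffOn_pd hU (hg.contDiffOn_inv α β) α).add
      ((hg.contDiffOn_inv α β).mul (contDiffOn_pd hU (contDiffOn_logSqrtDet hg) α))
  exact h.congr fun x hx => laplacianDrift_eq hU hg hx β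

lemma IsMetricOn.mul_inv_cancel (hg : IsMetricOn U g) {x : Fin n → ℝ} (hx : x ∈ U) :
    g x * (g x)⁻¹ = 1 :=
  Matrix.mul_nonsing_inv _ (isUnit_iff_ne_zero.2 (hg.nondegenerate x hx))

lemma IsMetricOn.inv_mul_cancel (hg : IsMetricOn U g) {x : Fin n → ℝ} (hx : x ∈ U) :
    (g x)⁻¹ * g x = 1 :=
  Matrix.nonsing_inv_mul _ (isUnit_iff_ne_zero.2 (hg.nondegenerate x hx))

lemma IsMetricOn.inv_symm (hg : IsMetricOn U g) {x : Fin n → ℝ} (hx : x ∈ U) (α β : Fin n) :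
    (g x)⁻¹ α β = (g x)⁻¹ β α := by
  have h : ((g x)⁻¹).transpose = (g x)⁻¹ := by rw [Matrix.transpose_nonsing_inv, (hg.symm x hx).eq]
  exact congrFun (congrFun h β) α

lemma IsMetricOn.symm_apply (hg : IsMetricOn U g) {x : Fin n → ℝ} (hx : x ∈ U) (α β : Fin n) :
    g x α β = g x β α := (hg.symm x hx).apply β α

/-- Derivative of the inverse metric. -/
lemma pd_inv (hU : IsOpen U) (hg : IsMetricOn U g) {x : Fin n → ℝ} (hx : x ∈ U) (γ : Fin n) :
    (Matrix.of fun α β => pd γ (fun y => (g y)⁻¹ α β) x)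
      = -((g x)⁻¹ * (Matrix.of fun α β => pd γ (fun y => g y α β) x) * (g x)⁻¹) := by
  have h : (Matrix.of fun α β => pd γ (fun y => (g y)⁻¹ α β) x) * g x
      + (g x)⁻¹ * (Matrix.of fun α β => pd γ (fun y => g y α β) x) = 0 := by
    ext α β
    have hA := fun δ => differentiableAt_of_contDiffOn hU (hg.contDiffOn_inv α δ) hx
    have hG := fun δ => differentiableAt_of_contDiffOn hU (hg.smooth δ β) hx
    have h1 : pd γ (fun y => ∑ δ, (g y)⁻¹ α δ * g y δ β) x = 0 := by
      have : Set.EqOn (fun y => ∑ δ, (g y)⁻¹ α δ * g y δ β)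
          (fun _ => (1 : Matrix (Fin n) (Fin n) ℝ) α β) U := by
        intro y hy
        simp only [← hg.inv_mul_cancel hy, Matrix.mul_apply]
      rw [pd_eq_dirDeriv, dirDeriv_congr hU this _ hx, dirDeriv_const]
    rw [pd_eq_dirDeriv, dirDeriv_sum fun δ _ => (hA δ).fun_mul (hG δ)] at h1
    simp only [dirDeriv_mul (hA _) (hG _), Finset.sum_add_distrib] at h1
    simpa [Matrix.mul_apply, pd_eq_dirDeriv] using h1
  have h2 := congrArg (· * (g x)⁻¹) h
  simp only [add_mul, Matrix.mul_assoc, hg.mul_inv_cancel hx, mul_one, zero_mul] at h2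
  rw [Matrix.mul_assoc]
  exact eq_neg_of_add_eq_zero_left h2

/-- A vector field is homothetic exactly if it rescales the inverse metric. -/
lemma lieMetric_eq_iff (hU : IsOpen U) (hg : IsMetricOn U g) {x : Fin n → ℝ} (hx : x ∈ U)
    (Y : (Fin n → ℝ) → Fin n → ℝ) (c : ℝ) :
    (∀ α β, lieMetric Y g x α β = c * g x α β) ↔
      ∀ α β, ∑ γ, Y x γ * pd γ (fun y => (g y)⁻¹ α β) x
        = ∑ γ, ((g x)⁻¹ α γ * pd γ (fun y => Y y β) x
          + (g x)⁻¹ γ β * pd γ (fun y => Y y α) x) - c * (g x)⁻¹ α β := by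
  set A := (g x)⁻¹ with hA
  set G' : Matrix (Fin n) (Fin n) ℝ := Matrix.of fun α β => ∑ γ, Y x γ * pd γ (fun y => g y α β) x
    with hG'
  set A' : Matrix (Fin n) (Fin n) ℝ :=
    Matrix.of fun α β => ∑ γ, Y x γ * pd γ (fun y => (g y)⁻¹ α β) x with hA'
  set N : Matrix (Fin n) (Fin n) ℝ := Matrix.of fun α γ => pd α (fun y => Y y γ) x with hN
  have hAG : A * g x = 1 := hg.inv_mul_cancel hx
  have hGA : g x * A = 1 := hg.mul_inv_cancel hx
  have e1 : A' = ∑ γ, Y x γ • Matrix.of fun α β => pd γ (fun y => (g y)⁻¹ α β) x := by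
    ext α β
    simp [hA', Matrix.sum_apply]
  have e2 : G' = ∑ γ, Y x γ • Matrix.of fun α β => pd γ (fun y => g y α β) x := by
    ext α β
    simp [hG', Matrix.sum_apply]
  have key : A' = -(A * G' * A) := by
    rw [e1, e2]
    simp only [pd_inv hU hg hx, Finset.mul_sum, Finset.sum_mul, Matrix.mul_smul, Matrix.smul_mul,
      smul_neg, Finset.sum_neg_distrib, hA]
  have key2 : G' = -(g x * A' * g x) := by
    have : g x * A' * g x = -((g x * A) * G' * (A * g x)) := by
      rw [key]
      noncomm_ring
    rw [this, hAG, hGA]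
    simp
  -- In matrix form the two sides are `G' + N g + g Nᵀ = c g` and `A' = A N + Nᵀ A - c A`;
  -- multiplying by `A` (or `g`) on both sides passes from one to the other.
  have l1 : (∀ α β, lieMetric Y g x α β = c * g x α β) ↔
      G' + N * g x + g x * N.transpose = c • g x := by
    rw [← Matrix.ext_iff]
    refine forall_congr' fun α => forall_congr' fun β => ?_
    have : lieMetric Y g x α β = (G' + N * g x + g x * N.transpose) α β := by
      simp only [lieMetric, Finset.sum_add_distrib, Matrix.add_apply, Matrix.mul_apply, hG', hN,
        Matrix.of_apply, Matrix.transpose_apply]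
      simp only [mul_comm]
    rw [this, Matrix.smul_apply, smul_eq_mul]
  have l2 : (∀ α β, ∑ γ, Y x γ * pd γ (fun y => (g y)⁻¹ α β) x
        = ∑ γ, (A α γ * pd γ (fun y => Y y β) x + A γ β * pd γ (fun y => Y y α) x)
          - c * A α β) ↔ A' = A * N + N.transpose * A - c • A := by
    rw [← Matrix.ext_iff]
    refine forall_congr' fun α => forall_congr' fun β => ?_
    have : (A * N + N.transpose * A - c • A) α β = ∑ γ, (A α γ * pd γ (fun y => Y y β) x
        + A γ β * pd γ (fun y => Y y α) x) - c * A α β := by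
      simp only [Finset.sum_add_distrib, Matrix.sub_apply, Matrix.add_apply, Matrix.mul_apply, hN,
        Matrix.of_apply, Matrix.transpose_apply, Matrix.smul_apply, smul_eq_mul]
      simp only [mul_comm]
    rw [this]
    rfl
  rw [l1, l2]
  constructor
  · intro h
    have h' : G' = c • g x - N * g x - g x * N.transpose := by rw [← h]; abel
    have : A * G' * A = c • (A * (g x * A)) - A * N * (g x * A) - (A * g x) * N.transpose * A := by
      rw [h']
      simp only [mul_sub, sub_mul, Matrix.mul_assoc, Matrix.mul_smul, Matrix.smul_mul]
    rw [key, this, hAG, hGA]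
    simp only [mul_one, one_mul]
    abel
  · intro h
    have : g x * A' * g x = (g x * A) * N * g x + g x * N.transpose * (A * g x)
        - c • (g x * (A * g x)) := by
      rw [h]
      simp only [mul_sub, sub_mul, mul_add, add_mul, Matrix.mul_assoc, Matrix.mul_smul,
        Matrix.smul_mul]
    rw [key2, this, hAG, hGA]
    simp only [mul_one, one_mul]
    abel

/-- The divergence of a homothetic vector field. -/
lemma IsHomotheticOn.apply_logSqrtDet (hU : IsOpen U) (hg : IsMetricOn U g)
    {Y : (Fin n → ℝ) → Fin n → ℝ} {ψ : ℝ} (hY : IsHomotheticOn U g Y ψ) {x : Fin n → ℝ}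
    (hx : x ∈ U) :
    ∑ γ, Y x γ * pd γ (logSqrtDet g) x = n * ψ - ∑ γ, pd γ (fun y => Y y γ) x := by
  have hdet := hg.nondegenerate x hx
  have hpd : ∀ γ, pd γ (logSqrtDet g) x
      = 1 / 2 * ∑ α, ∑ β, (g x)⁻¹ β α * pd γ (fun y => g y α β) x := by
    intro γ
    have hl : dirDeriv (Pi.single γ 1) (fun y => Real.log (g y).det) x
        = ((g x).det)⁻¹ * dirDeriv (Pi.single γ 1) (fun y => (g y).det) x := by
      unfold dirDeriv
      rw [((differentiableAt_of_contDiffOn hU hg.contDiffOn_det hx).hasFDerivAt.log hdet).fderiv]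
      rfl
    rw [pd_eq_dirDeriv]
    unfold logSqrtDet
    rw [dirDeriv_const_mul ((differentiableAt_of_contDiffOn hU hg.contDiffOn_det hx).log hdet),
      hl, dirDeriv_det fun i j => differentiableAt_of_contDiffOn hU (hg.smooth i j) hx,
      Matrix.trace_mul_comm, Matrix.trace]
    congr 1
    rw [Finset.mul_sum]
    refine Finset.sum_congr rfl fun α _ => ?_
    rw [Matrix.diag_apply, Matrix.mul_apply, Finset.mul_sum]
    refine Finset.sum_congr rfl fun β _ => ?_
    rw [Matrix.inv_def, Ring.inverse_eq_inv', Matrix.smul_apply, smul_eq_mul, Matrix.of_apply]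
    simp only [pd_eq_dirDeriv]
    ring
  -- Trace of `L_Y g = 2 ψ g` with the inverse metric: the two terms with derivatives of `Y` each
  -- contribute the coordinate divergence, and the term with derivatives of `g` contributes `2 Y(log
  -- √|g|)`.
  have hlie : ∑ α, ∑ β, (g x)⁻¹ β α * lieMetric Y g x α β = 2 * ψ * n := by
    simp only [hY.lie_eq x hx]
    have : ∀ β, ∑ α, (g x)⁻¹ β α * (2 * ψ * g x α β) = 2 * ψ := by
      intro β
      have h1 := congrFun (congrFun (hg.inv_mul_cancel hx) β) β
      rw [Matrix.mul_apply, Matrix.one_apply_eq] at h1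
      calc ∑ α, (g x)⁻¹ β α * (2 * ψ * g x α β) = 2 * ψ * ∑ α, (g x)⁻¹ β α * g x α β := by
            rw [Finset.mul_sum]
            exact Finset.sum_congr rfl fun α _ => by ring
        _ = 2 * ψ := by rw [h1, mul_one]
    rw [Finset.sum_comm]
    simp only [this, Finset.sum_const, Finset.card_univ, Fintype.card_fin, nsmul_eq_mul]
    ring
  have s1 : ∑ α, ∑ β, (g x)⁻¹ β α * ∑ γ, g x γ β * pd α (fun y => Y y γ) x
      = ∑ α, pd α (fun y => Y y α) x := by
    refine Finset.sum_congr rfl fun α _ => ?_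
    have : ∀ γ, ∑ β, (g x)⁻¹ β α * (g x γ β * pd α (fun y => Y y γ) x)
        = (1 : Matrix (Fin n) (Fin n) ℝ) γ α * pd α (fun y => Y y γ) x := by
      intro γ
      rw [← hg.mul_inv_cancel hx, Matrix.mul_apply, Finset.sum_mul]
      exact Finset.sum_congr rfl fun β _ => by ring
    simp only [Finset.mul_sum]
    rw [Finset.sum_comm]
    simp [this, Matrix.one_apply]
  have s2 : ∑ α, ∑ β, (g x)⁻¹ β α * ∑ γ, g x α γ * pd β (fun y => Y y γ) x
      = ∑ α, pd α (fun y => Y y α) x := by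
    rw [← s1, Finset.sum_comm]
    refine Finset.sum_congr rfl fun α _ => Finset.sum_congr rfl fun β _ => ?_
    rw [hg.inv_symm hx]
    congr 1
    exact Finset.sum_congr rfl fun γ _ => by rw [hg.symm_apply hx]
  have s3 : ∑ α, ∑ β, (g x)⁻¹ β α * ∑ γ, Y x γ * pd γ (fun y => g y α β) x
      = 2 * ∑ γ, Y x γ * pd γ (logSqrtDet g) x := by
    simp only [hpd, Finset.mul_sum]
    rw [Finset.sum_congr rfl fun α _ => Finset.sum_comm, Finset.sum_comm]
    refine Finset.sum_congr rfl fun γ _ => Finset.sum_congr rfl fun α _ =>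
      Finset.sum_congr rfl fun β _ => ?_
    ring
  simp only [lieMetric, Finset.sum_add_distrib, mul_add] at hlie
  rw [s1, s2, s3] at hlie
  linarith

lemma sum_sum_sub_swap {m : Type*} [Fintype m] (f : m → m → ℝ) :
    ∑ α, ∑ γ, (f α γ - f γ α) = 0 := by
  simp only [Finset.sum_sub_distrib]
  rw [Finset.sum_comm, sub_self]

/-- The index algebra behind `IsHomotheticOn.apply_laplacianDrift`: `A` is the inverse metric, `s`
the gradient of `log √|g|`, and each `d` marks a derivative, whose index comes first. `F1` is the
differentiated `F3`, and `F2` the differentiated divergence formula. After substitution the surplus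
terms have the form `f α γ - f γ α` and cancel in the double sum. -/
lemma drift_identity {m : Type*} [Fintype m] (c : ℝ) (β : m) (Y s : m → ℝ) (A dY ds : m → m → ℝ)
    (dA ddY : m → m → m → ℝ) (ddA : m → m → m → m → ℝ)
    (hddY : ∀ α γ δ, ddY α γ δ = ddY γ α δ)
    (F1 : ∀ α, ∑ γ, (dY α γ * dA γ α β + Y γ * ddA α γ α β)
      = ∑ γ, (dA α α γ * dY γ β + A α γ * ddY α γ β + (dA α γ β * dY γ α + A γ β * ddY α γ α))
        - c * dA α α β)
    (F2 : ∀ α, ∑ γ, (dY α γ * s γ + Y γ * ds α γ) = -∑ γ, ddY α γ γ)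
    (F3 : ∀ α, ∑ γ, Y γ * dA γ α β = ∑ γ, (A α γ * dY γ β + A γ β * dY γ α) - c * A α β) :
    ∑ γ, Y γ * ∑ α, (ddA α γ α β + (dA γ α β * s α + A α β * ds α γ))
      = ∑ α, ∑ γ, A α γ * ddY α γ β
        + ∑ γ, (∑ α, (dA α α γ + A α γ * s α)) * dY γ β
        - c * ∑ α, (dA α α β + A α β * s α) := by
  have e1 : ∑ γ, Y γ * ∑ α, (ddA α γ α β + (dA γ α β * s α + A α β * ds α γ))
      = ∑ α, (∑ γ, Y γ * ddA α γ α β + s α * ∑ γ, Y γ * dA γ α β + A α β * ∑ γ, Y γ * ds α γ) := by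
    simp only [Finset.mul_sum]
    rw [Finset.sum_comm]
    refine Finset.sum_congr rfl fun α _ => ?_
    rw [← Finset.sum_add_distrib, ← Finset.sum_add_distrib]
    exact Finset.sum_congr rfl fun γ _ => by ring
  have e2 : ∀ α, ∑ γ, Y γ * ddA α γ α β + s α * ∑ γ, Y γ * dA γ α β + A α β * ∑ γ, Y γ * ds α γ
      = ∑ γ, A α γ * ddY α γ β + ∑ γ, (dA α α γ + A α γ * s α) * dY γ β
        - c * (dA α α β + A α β * s α)
        + ∑ γ, ((dA α γ β * dY γ α + A γ β * ddY γ α α + A γ β * dY γ α * s α)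
          - (dA γ α β * dY α γ + A α β * ddY α γ γ + A α β * dY α γ * s γ)) := by
    intro α
    have f1 := F1 α
    have f2 := F2 α
    simp only [Finset.sum_add_distrib] at f1 f2
    rw [F3 α, eq_sub_of_add_eq' f1, eq_sub_of_add_eq' f2]
    simp only [Finset.sum_add_distrib, Finset.sum_sub_distrib, mul_add, add_mul, mul_sub,
      mul_neg, hddY α _ α]
    have g1 : ∑ γ, A γ β * dY γ α * s α = s α * ∑ γ, A γ β * dY γ α := by
      rw [Finset.mul_sum]
      exact Finset.sum_congr rfl fun γ _ => by ring
    have g2 : ∑ γ, A α γ * s α * dY γ β = s α * ∑ γ, A α γ * dY γ β := by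
      rw [Finset.mul_sum]
      exact Finset.sum_congr rfl fun γ _ => by ring
    have g3 : ∑ γ, A α β * dY α γ * s γ = A α β * ∑ γ, dY α γ * s γ := by
      rw [Finset.mul_sum]
      exact Finset.sum_congr rfl fun γ _ => by ring
    have g4 : ∑ γ, dA γ α β * dY α γ = ∑ γ, dY α γ * dA γ α β :=
      Finset.sum_congr rfl fun γ _ => mul_comm _ _
    rw [g1, g2, g3, g4, Finset.mul_sum (f := fun γ => ddY α γ γ)]
    ring
  rw [e1, Finset.sum_congr rfl fun α _ => e2 α, Finset.sum_add_distrib, sum_sum_sub_swap fun α γ =>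
    dA α γ β * dY γ α + A γ β * ddY γ α α + A γ β * dY γ α * s α, add_zero,
    Finset.sum_sub_distrib, Finset.sum_add_distrib, Finset.mul_sum, Finset.sum_comm
      (f := fun α γ => (dA α α γ + A α γ * s α) * dY γ β)]
  simp only [Finset.sum_mul]

/-- A homothetic vector field rescales the Laplace operator, hence its drift. -/
lemma IsHomotheticOn.apply_laplacianDrift (hU : IsOpen U) (hg : IsMetricOn U g)
    {Y : (Fin n → ℝ) → Fin n → ℝ} {ψ : ℝ} (hY : IsHomotheticOn U g Y ψ) {x : Fin n → ℝ}
    (hx : x ∈ U) (β : Fin n) :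
    ∑ γ, Y x γ * pd γ (fun y => laplacianDrift g y β) x
      = ∑ α, ∑ γ, (g x)⁻¹ α γ * pd α (pd γ fun y => Y y β) x
        + ∑ γ, laplacianDrift g x γ * pd γ (fun y => Y y β) x
        - 2 * ψ * laplacianDrift g x β := by
  have hYs := fun γ => contDiffOn_component hY.smooth γ
  have hAs := hg.contDiffOn_inv
  have hσs := contDiffOn_logSqrtDet hg
  have D : ∀ {f : (Fin n → ℝ) → ℝ}, ContDiffOn ℝ ∞ f U → DifferentiableAt ℝ f x :=
    fun h => differentiableAt_of_contDiffOn hU h hx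
  have hcomm : ∀ {f : (Fin n → ℝ) → ℝ}, ContDiffOn ℝ ∞ f U → ∀ a b,
      pd a (pd b f) x = pd b (pd a f) x := fun h a b => dirDeriv_comm hU h _ _ hx
  have hpd := fun {f : (Fin n → ℝ) → ℝ} (h : ContDiffOn ℝ ∞ f U) a => contDiffOn_pd hU h a
  have F3 : ∀ y ∈ U, ∀ α β, ∑ γ, Y y γ * pd γ (fun y => (g y)⁻¹ α β) y
        = ∑ γ, ((g y)⁻¹ α γ * pd γ (fun y => Y y β) y
          + (g y)⁻¹ γ β * pd γ (fun y => Y y α) y) - 2 * ψ * (g y)⁻¹ α β :=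
    fun y hy => (lieMetric_eq_iff hU hg hy Y (2 * ψ)).1 (hY.lie_eq y hy)
  have F1 : ∀ α, ∑ γ, (pd α (fun y => Y y γ) x * pd γ (fun y => (g y)⁻¹ α β) x
        + Y x γ * pd α (pd γ (fun y => (g y)⁻¹ α β)) x)
      = ∑ γ, (pd α (fun y => (g y)⁻¹ α γ) x * pd γ (fun y => Y y β) x
        + (g x)⁻¹ α γ * pd α (pd γ (fun y => Y y β)) x
        + (pd α (fun y => (g y)⁻¹ γ β) x * pd γ (fun y => Y y α) x
        + (g x)⁻¹ γ β * pd α (pd γ (fun y => Y y α)) x))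
        - 2 * ψ * pd α (fun y => (g y)⁻¹ α β) x := by
    intro α
    have h := dirDeriv_congr hU (fun y hy => F3 y hy α β) (Pi.single α 1) hx
    rw [dirDeriv_sum fun γ _ => (D (hYs γ)).fun_mul (D (hpd (hAs α β) γ)),
      dirDeriv_sub (DifferentiableAt.fun_sum fun γ _ =>
        ((D (hAs α γ)).fun_mul (D (hpd (hYs β) γ))).fun_add ((D (hAs γ β)).fun_mul (D (hpd (hYs α) γ))))
        ((D (hAs α β)).const_mul _),
      dirDeriv_sum fun γ _ =>
        ((D (hAs α γ)).fun_mul (D (hpd (hYs β) γ))).fun_add ((D (hAs γ β)).fun_mul (D (hpd (hYs α) γ))),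
      dirDeriv_const_mul (D (hAs α β))] at h
    simp only [dirDeriv_add ((D (hAs α _)).fun_mul (D (hpd (hYs β) _)))
      ((D (hAs _ β)).fun_mul (D (hpd (hYs α) _))), dirDeriv_mul (D (hAs α _)) (D (hpd (hYs β) _)),
      dirDeriv_mul (D (hAs _ β)) (D (hpd (hYs α) _)),
      dirDeriv_mul (D (hYs _)) (D (hpd (hAs α β) _))] at h
    exact h
  -- The term `n ψ` of the divergence formula drops out because `ψ` is constant on `U`.
  have F2 : ∀ α, ∑ γ, (pd α (fun y => Y y γ) x * pd γ (logSqrtDet g) x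
        + Y x γ * pd α (pd γ (logSqrtDet g)) x) = -∑ γ, pd α (pd γ (fun y => Y y γ)) x := by
    intro α
    have h := dirDeriv_congr hU (fun y hy => hY.apply_logSqrtDet hU hg hy) (Pi.single α 1) hx
    rw [dirDeriv_sum fun γ _ => (D (hYs γ)).fun_mul (D (hpd hσs γ)),
      dirDeriv_sub (differentiableAt_const _) (DifferentiableAt.fun_sum fun γ _ =>
        D (hpd (hYs γ) γ)), dirDeriv_const, zero_sub,
      dirDeriv_sum fun γ _ => D (hpd (hYs γ) γ)] at h
    simp only [dirDeriv_mul (D (hYs _)) (D (hpd hσs _))] at h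
    exact h
  have F4 : ∀ γ, pd γ (fun y => laplacianDrift g y β) x
      = ∑ α, (pd α (pd γ (fun y => (g y)⁻¹ α β)) x
        + (pd γ (fun y => (g y)⁻¹ α β) x * pd α (logSqrtDet g) x
        + (g x)⁻¹ α β * pd α (pd γ (logSqrtDet g)) x)) := by
    intro γ
    rw [pd_eq_dirDeriv, dirDeriv_congr hU (fun y hy => laplacianDrift_eq hU hg hy β) _ hx,
      dirDeriv_sum fun α _ => (D (hpd (hAs α β) α)).fun_add ((D (hAs α β)).fun_mul (D (hpd hσs α)))]
    refine Finset.sum_congr rfl fun α _ => ?_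
    rw [dirDeriv_add (D (hpd (hAs α β) α)) ((D (hAs α β)).fun_mul (D (hpd hσs α))),
      dirDeriv_mul (D (hAs α β)) (D (hpd hσs α)), hcomm (hAs α β) α γ, hcomm hσs α γ]
    rfl
  have hcY : ∀ α γ δ, pd α (pd γ (fun y => Y y δ)) x = pd γ (pd α (fun y => Y y δ)) x :=
    fun α γ δ => hcomm (hYs δ) α γ
  have F3x := fun α => F3 x hx α β
  simp only [laplacianDrift_eq hU hg hx, F4]
  exact drift_identity (2 * ψ) β (Y x) (fun α => pd α (logSqrtDet g) x) (fun α β => (g x)⁻¹ α β)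
    (fun α γ => pd α (fun y => Y y γ) x) (fun α γ => pd α (pd γ (logSqrtDet g)) x)
    (fun γ α β => pd γ (fun y => (g y)⁻¹ α β) x) (fun α γ δ => pd α (pd γ fun y => Y y δ) x)
    (fun α γ δ β => pd α (pd γ fun y => (g y)⁻¹ δ β) x) hcY F1 F2 F3x

end Geometry

/-! ### The homothetic algebra and its finite dimension. -/

section Homothetic

variable {n : ℕ} {U : Set (Fin n → ℝ)} {g : (Fin n → ℝ) → Matrix (Fin n) (Fin n) ℝ}

lemma IsHomotheticOn.congr (hU : IsOpen U) {Y Z : (Fin n → ℝ) → Fin n → ℝ} {ψ : ℝ}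
    (hY : IsHomotheticOn U g Y ψ) (h : ∀ x ∈ U, Z x = Y x) : IsHomotheticOn U g Z ψ where
  smooth := hY.smooth.congr h
  lie_eq x hx α β := by
    have e : ∀ α γ, pd α (fun y => Z y γ) x = pd α (fun y => Y y γ) x := fun α γ =>
      dirDeriv_congr hU (fun y hy => congrFun (h y hy) γ) _ hx
    rw [← hY.lie_eq x hx α β]
    simp only [lieMetric, e, h x hx]

lemma isHomotheticOn_zero : IsHomotheticOn U g (fun _ => 0) 0 where
  smooth := contDiffOn_const
  lie_eq x hx α β := by
    simp [lieMetric, pd_eq_dirDeriv]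

lemma IsHomotheticOn.add (hU : IsOpen U) {Y Z : (Fin n → ℝ) → Fin n → ℝ} {ψ χ : ℝ}
    (hY : IsHomotheticOn U g Y ψ) (hZ : IsHomotheticOn U g Z χ) :
    IsHomotheticOn U g (fun x => Y x + Z x) (ψ + χ) where
  smooth := hY.smooth.add hZ.smooth
  lie_eq x hx α β := by
    have e : ∀ α γ, pd α (fun y => Y y γ + Z y γ) x
        = pd α (fun y => Y y γ) x + pd α (fun y => Z y γ) x := fun α γ =>
      dirDeriv_add (differentiableAt_of_contDiffOn hU (contDiffOn_component hY.smooth γ) hx)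
        (differentiableAt_of_contDiffOn hU (contDiffOn_component hZ.smooth γ) hx) _
    have h : lieMetric (fun x => Y x + Z x) g x α β
        = lieMetric Y g x α β + lieMetric Z g x α β := by
      simp only [lieMetric, Pi.add_apply, e, ← Finset.sum_add_distrib]
      exact Finset.sum_congr rfl fun γ _ => by ring
    rw [h, hY.lie_eq x hx, hZ.lie_eq x hx]
    ring

lemma IsHomotheticOn.smul (hU : IsOpen U) {Y : (Fin n → ℝ) → Fin n → ℝ} {ψ : ℝ}
    (hY : IsHomotheticOn U g Y ψ) (c : ℝ) : IsHomotheticOn U g (fun x => c • Y x) (c * ψ) where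
  smooth := hY.smooth.const_smul c
  lie_eq x hx α β := by
    have e : ∀ α γ, pd α (fun y => c * Y y γ) x = c * pd α (fun y => Y y γ) x := fun α γ =>
      dirDeriv_const_mul
        (differentiableAt_of_contDiffOn hU (contDiffOn_component hY.smooth γ) hx) _ _
    have h : lieMetric (fun x => c • Y x) g x α β = c * lieMetric Y g x α β := by
      simp only [lieMetric, Pi.smul_apply, smul_eq_mul, e, Finset.mul_sum]
      exact Finset.sum_congr rfl fun γ _ => by ring
    rw [h, hY.lie_eq x hx]
    ring

lemma IsHomotheticOn.sum_smul (hU : IsOpen U) {κ : Type*} (u : Finset κ)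
    {Y : κ → (Fin n → ℝ) → Fin n → ℝ} {ψ : κ → ℝ} (hY : ∀ I, IsHomotheticOn U g (Y I) (ψ I))
    (c : κ → ℝ) : IsHomotheticOn U g (fun x => ∑ I ∈ u, c I • Y I x) (∑ I ∈ u, c I * ψ I) := by
  classical
  induction u using Finset.induction_on with
  | empty => simpa using isHomotheticOn_zero
  | insert I u hI ih =>
    simp only [Finset.sum_insert hI]
    exact ((hY I).smul hU (c I)).add hU ih

/-- Positivity of `n` matters: the empty matrix has determinant 1 but no entries. -/
lemma IsMetricOn.exists_ne_zero (hn : 0 < n) (hg : IsMetricOn U g) {x : Fin n → ℝ} (hx : x ∈ U) :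
    ∃ α β, g x α β ≠ 0 := by
  by_contra! h
  have : Nonempty (Fin n) := ⟨⟨0, hn⟩⟩
  have h0 : g x = 0 := by
    ext α β
    exact h α β
  exact hg.nondegenerate x hx (by rw [h0, Matrix.det_zero])

/-- The equation that the second derivatives of a Killing vector field satisfy. -/
lemma IsHomotheticOn.second_derivative (hU : IsOpen U) (hg : IsMetricOn U g)
    {Y : (Fin n → ℝ) → Fin n → ℝ} (hY : IsHomotheticOn U g Y 0) {x : Fin n → ℝ} (hx : x ∈ U)
    (α β δ : Fin n) :
    ∑ γ, g x β γ * pd δ (pd α fun y => Y y γ) x + ∑ γ, g x α γ * pd δ (pd β fun y => Y y γ) x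
      = -∑ γ, (pd δ (fun y => Y y γ) x * pd γ (fun y => g y α β) x
        + Y x γ * pd δ (pd γ fun y => g y α β) x
        + pd δ (fun y => g y γ β) x * pd α (fun y => Y y γ) x
        + pd δ (fun y => g y α γ) x * pd β (fun y => Y y γ) x) := by
  have hYs := fun γ => contDiffOn_component hY.smooth γ
  have D : ∀ {f : (Fin n → ℝ) → ℝ}, ContDiffOn ℝ ∞ f U → DifferentiableAt ℝ f x :=
    fun h => differentiableAt_of_contDiffOn hU h hx
  have hpd := fun {f : (Fin n → ℝ) → ℝ} (h : ContDiffOn ℝ ∞ f U) a => contDiffOn_pd hU h a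
  have d1 := fun γ => (D (hYs γ)).fun_mul (D (hpd (hg.smooth α β) γ))
  have d2 := fun γ => (D (hg.smooth γ β)).fun_mul (D (hpd (hYs γ) α))
  have d3 := fun γ => (D (hg.smooth α γ)).fun_mul (D (hpd (hYs γ) β))
  have h0 : Set.EqOn (fun y => lieMetric Y g y α β) (fun _ => 0) U := fun y hy => by
    simpa using hY.lie_eq y hy α β
  have h := dirDeriv_congr hU h0 (Pi.single δ 1) hx
  unfold lieMetric at h
  rw [dirDeriv_const, dirDeriv_sum fun γ _ => ((d1 γ).fun_add (d2 γ)).fun_add (d3 γ)] at h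
  simp only [dirDeriv_add ((d1 _).fun_add (d2 _)) (d3 _), dirDeriv_add (d1 _) (d2 _),
    dirDeriv_mul (D (hYs _)) (D (hpd (hg.smooth α β) _)),
    dirDeriv_mul (D (hg.smooth _ β)) (D (hpd (hYs _) α)),
    dirDeriv_mul (D (hg.smooth α _)) (D (hpd (hYs _) β))] at h
  rw [eq_neg_iff_add_eq_zero, ← h, ← Finset.sum_add_distrib, ← Finset.sum_add_distrib]
  refine Finset.sum_congr rfl fun γ _ => ?_
  rw [hg.symm_apply hx β γ]
  simp only [pd_eq_dirDeriv]
  ring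

lemma abs_sum_mul_le {m : Type*} [Fintype m] {f h : m → ℝ} {K L : ℝ} (hK : ∀ i, |f i| ≤ K)
    (hL : ∀ i, |h i| ≤ L) : |∑ i, f i * h i| ≤ Fintype.card m * (K * L) := by
  refine (Finset.abs_sum_le_sum_abs _ _).trans ((Finset.sum_le_card_nsmul _ _ (K * L) ?_).trans ?_)
  · intro i _
    rw [abs_mul]
    exact mul_le_mul (hK i) (hL i) (abs_nonneg _) ((abs_nonneg _).trans (hK i))
  · simp [Finset.card_univ]

/-- The second derivatives of a Killing vector field are bounded by its first jet. -/
lemma IsHomotheticOn.abs_second_derivative_le (hU : IsOpen U) (hg : IsMetricOn U g)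
    {Y : (Fin n → ℝ) → Fin n → ℝ} (hY : IsHomotheticOn U g Y 0) {x : Fin n → ℝ} (hx : x ∈ U)
    {M R : ℝ} (hA : ∀ α β, |(g x)⁻¹ α β| ≤ M) (hG : ∀ α β γ, |pd γ (fun y => g y α β) x| ≤ M)
    (hGG : ∀ α β γ δ, |pd δ (pd γ fun y => g y α β) x| ≤ M)
    (hR : ∀ γ, |Y x γ| ≤ R) (hR' : ∀ α γ, |pd α (fun y => Y y γ) x| ≤ R) (α γ δ : Fin n) :
    |pd δ (pd α fun y => Y y γ) x| ≤ n * (M * (6 * n * (M * R))) := by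
  have hYs := fun γ => contDiffOn_component hY.smooth γ
  have hcomm : ∀ a b c, pd a (pd b fun y => Y y c) x = pd b (pd a fun y => Y y c) x :=
    fun a b c => dirDeriv_comm hU (hYs c) _ _ hx
  have hL : ∀ α β δ, |∑ γ, (pd δ (fun y => Y y γ) x * pd γ (fun y => g y α β) x
        + Y x γ * pd δ (pd γ fun y => g y α β) x
        + pd δ (fun y => g y γ β) x * pd α (fun y => Y y γ) x
        + pd δ (fun y => g y α γ) x * pd β (fun y => Y y γ) x)| ≤ 4 * n * (M * R) := by
    intro α β δ
    have b1 := abs_sum_mul_le (fun γ => hR' δ γ) (fun γ => hG α β γ)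
    have b2 := abs_sum_mul_le hR (fun γ => hGG α β γ δ)
    have b3 := abs_sum_mul_le (fun γ => hG γ β δ) (fun γ => hR' α γ)
    have b4 := abs_sum_mul_le (fun γ => hG α γ δ) (fun γ => hR' β γ)
    simp only [Finset.sum_add_distrib]
    rw [Fintype.card_fin] at b1 b2 b3 b4
    refine (abs_add_le _ _).trans ?_
    have t1 := abs_add_le (∑ γ, pd δ (fun y => Y y γ) x * pd γ (fun y => g y α β) x
      + ∑ γ, Y x γ * pd δ (pd γ fun y => g y α β) x)
      (∑ γ, pd δ (fun y => g y γ β) x * pd α (fun y => Y y γ) x)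
    have t2 := abs_add_le (∑ γ, pd δ (fun y => Y y γ) x * pd γ (fun y => g y α β) x)
      (∑ γ, Y x γ * pd δ (pd γ fun y => g y α β) x)
    rw [mul_comm R M] at b1 b2
    linarith
  have hS : ∀ β, |∑ γ, g x β γ * pd δ (pd α fun y => Y y γ) x| ≤ 6 * n * (M * R) := by
    intro β
    -- As for Christoffel symbols, `e1 + e2 - e3` isolates twice the wanted term. Three right-hand
    -- sides bounded by `4 n M R`, divided by 2, give `6 n M R`.
    have e1 := hY.second_derivative hU hg hx α β δ
    have e2 := hY.second_derivative hU hg hx β δ α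
    have e3 := hY.second_derivative hU hg hx δ α β
    simp only [hcomm α δ, hcomm β δ, hcomm β α] at e1 e2 e3
    have l1 := abs_le.1 (hL α β δ)
    have l2 := abs_le.1 (hL β δ α)
    have l3 := abs_le.1 (hL δ α β)
    rw [abs_le]
    constructor <;> linarith [l1.1, l1.2, l2.1, l2.2, l3.1, l3.2]
  have hinv : pd δ (pd α fun y => Y y γ) x
      = ∑ β, (g x)⁻¹ γ β * ∑ κ, g x β κ * pd δ (pd α fun y => Y y κ) x := by
    have h := congrArg (fun N : Matrix (Fin n) (Fin n) ℝ =>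
      N.mulVec (fun κ => pd δ (pd α fun y => Y y κ) x) γ) (hg.inv_mul_cancel hx)
    simp only [← Matrix.mulVec_mulVec, Matrix.one_mulVec] at h
    rw [← h]
    rfl
  rw [hinv]
  have := abs_sum_mul_le (fun β => hA γ β) hS
  rwa [Fintype.card_fin] at this

/-- The first jet of a vector field. -/
noncomputable def firstJet (Y : (Fin n → ℝ) → Fin n → ℝ) (x : Fin n → ℝ) :
    (Fin n → ℝ) × (Fin n → Fin n → ℝ) := (Y x, fun α γ => pd α (fun y => Y y γ) x)

lemma contDiffOn_firstJet (hU : IsOpen U) {Y : (Fin n → ℝ) → Fin n → ℝ}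
    (hY : ContDiffOn ℝ ∞ Y U) : ContDiffOn ℝ ∞ (firstJet Y) U :=
  hY.prodMk (contDiffOn_pi.2 fun α => contDiffOn_pi.2 fun γ =>
    contDiffOn_pd hU (contDiffOn_component hY γ) α)

/-- A Killing vector field whose first jet vanishes at a point vanishes near that point. -/
lemma IsHomotheticOn.eventually_firstJet_eq_zero (hU : IsOpen U) (hg : IsMetricOn U g)
    {Y : (Fin n → ℝ) → Fin n → ℝ} (hY : IsHomotheticOn U g Y 0) {x₀ : Fin n → ℝ} (hx₀ : x₀ ∈ U)
    (h0 : firstJet Y x₀ = 0) : ∀ᶠ x in nhds x₀, firstJet Y x = 0 := by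
  have hYs := fun γ => contDiffOn_component hY.smooth γ
  have bound : ∀ {f : (Fin n → ℝ) → ℝ}, ContDiffOn ℝ ∞ f U →
      ∃ M, ∀ᶠ x in nhds x₀, |f x| ≤ M := fun {f} hf =>
    ⟨|f x₀| + 1, ((hf.continuousOn.continuousAt (hU.mem_nhds hx₀)).abs.eventually
      (gt_mem_nhds (lt_add_one _))).mono fun _ h => h.le⟩
  choose M₁ hM₁ using fun α β => bound (hg.contDiffOn_inv α β)
  choose M₂ hM₂ using fun α β γ => bound (contDiffOn_pd hU (hg.smooth α β) γ)
  choose M₃ hM₃ using fun α β γ δ => bound (contDiffOn_pd hU (contDiffOn_pd hU (hg.smooth α β) γ) δ)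
  obtain ⟨M, hM⟩ : ∃ M, (∀ α β, M₁ α β ≤ M) ∧ (∀ α β γ, M₂ α β γ ≤ M) ∧
      ∀ α β γ δ, M₃ α β γ δ ≤ M := by
    obtain ⟨m₁, h₁⟩ := (Set.finite_range fun p : Fin n × Fin n => M₁ p.1 p.2).bddAbove
    obtain ⟨m₂, h₂⟩ :=
      (Set.finite_range fun p : Fin n × Fin n × Fin n => M₂ p.1 p.2.1 p.2.2).bddAbove
    obtain ⟨m₃, h₃⟩ := (Set.finite_range fun p : Fin n × Fin n × Fin n × Fin n =>
      M₃ p.1 p.2.1 p.2.2.1 p.2.2.2).bddAbove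
    exact ⟨max m₁ (max m₂ m₃),
      fun α β => (h₁ ⟨(α, β), rfl⟩).trans (le_max_left _ _),
      fun α β γ => (h₂ ⟨(α, β, γ), rfl⟩).trans ((le_max_left _ _).trans (le_max_right _ _)),
      fun α β γ δ => (h₃ ⟨(α, β, γ, δ), rfl⟩).trans ((le_max_right _ _).trans (le_max_right _ _))⟩
  have hev : ∀ᶠ x in nhds x₀, x ∈ U ∧ (∀ α β, |(g x)⁻¹ α β| ≤ M₁ α β) ∧
      (∀ α β γ, |pd γ (fun y => g y α β) x| ≤ M₂ α β γ) ∧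
      ∀ α β γ δ, |pd δ (pd γ fun y => g y α β) x| ≤ M₃ α β γ δ := by
    refine Filter.Eventually.and (hU.mem_nhds hx₀) (Filter.Eventually.and ?_ (Filter.Eventually.and ?_ ?_))
    · simpa only [Filter.eventually_all] using hM₁
    · simpa only [Filter.eventually_all] using hM₂
    · simpa only [Filter.eventually_all] using hM₃
  obtain ⟨ε, hε, hball⟩ := Metric.eventually_nhds_iff_ball.1 hev
  refine Metric.eventually_nhds_iff_ball.2 ⟨ε, hε, fun x hx => ?_⟩
  set v := x - x₀ with hv
  -- The entry 1 covers the derivatives of `Y`, which are themselves part of the first jet; the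
  -- other entry covers the second derivatives.
  set K : ℝ := max 1 (n * (M * (6 * n * M))) with hK
  have hseg : ∀ t ∈ Set.Icc (0 : ℝ) 1, x₀ + t • v ∈ Metric.ball x₀ ε := by
    intro t ht
    rw [mem_ball_iff_norm, add_sub_cancel_left, norm_smul, Real.norm_of_nonneg ht.1]
    have h1 : ‖v‖ < ε := mem_ball_iff_norm.1 hx
    nlinarith [norm_nonneg v, ht.2]
  have hF := contDiffOn_firstJet hU hY.smooth
  have hderiv : ∀ t ∈ Set.Icc (0 : ℝ) 1, HasDerivAt (fun t : ℝ => firstJet Y (x₀ + t • v))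
      (fderiv ℝ (firstJet Y) (x₀ + t • v) v) t := by
    intro t ht
    have hd := differentiableAt_of_contDiffOn hU hF (hball _ (hseg t ht)).1
    have hl : HasDerivAt (fun t : ℝ => x₀ + t • v) v t := by
      simpa using ((hasDerivAt_id t).smul_const v).const_add x₀
    exact hd.hasFDerivAt.comp_hasDerivAt t hl
  have hbound : ∀ t ∈ Set.Ico (0 : ℝ) 1, ‖fderiv ℝ (firstJet Y) (x₀ + t • v) v‖
      ≤ (n * (‖v‖ * K)) * ‖firstJet Y (x₀ + t • v)‖ := by
    intro t ht
    have hb := hball _ (hseg t (Set.Ico_subset_Icc_self ht))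
    set y := x₀ + t • v with hy
    set R := ‖firstJet Y y‖ with hR
    have hR0 : 0 ≤ R := norm_nonneg _
    have r1 : ∀ γ, |Y y γ| ≤ R := fun γ => (norm_le_pi_norm (Y y) γ).trans (norm_fst_le (firstJet Y y))
    have r2 : ∀ α γ, |pd α (fun z => Y z γ) y| ≤ R := fun α γ =>
      ((norm_le_pi_norm ((firstJet Y y).2 α) γ).trans (norm_le_pi_norm (firstJet Y y).2 α)).trans
        (norm_snd_le (firstJet Y y))
    have r3 := hY.abs_second_derivative_le hU hg hb.1
      (fun α β => (hb.2.1 α β).trans (hM.1 α β))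
      (fun α β γ => (hb.2.2.1 α β γ).trans (hM.2.1 α β γ))
      (fun α β γ δ => (hb.2.2.2 α β γ δ).trans (hM.2.2 α β γ δ)) r1 r2
    have r2' : ∀ α γ, |pd α (fun z => Y z γ) y| ≤ K * R := fun α γ =>
      (r2 α γ).trans (le_mul_of_one_le_left hR0 (le_max_left _ _))
    have r3' : ∀ α γ δ, |pd δ (pd α fun z => Y z γ) y| ≤ K * R := fun α γ δ =>
      (r3 α γ δ).trans (by
        have := mul_le_mul_of_nonneg_right (le_max_right 1 (n * (M * (6 * n * M)))) hR0
        linarith)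
    have comp : ∀ f : (Fin n → ℝ) → ℝ, (∀ δ, |pd δ f y| ≤ K * R) →
        |fderiv ℝ f y v| ≤ n * (‖v‖ * K) * R := by
      intro f hf
      rw [dirDeriv_pi_eq_sum]
      have := abs_sum_mul_le (fun i => norm_le_pi_norm v i) hf
      rw [Fintype.card_fin] at this
      exact this.trans_eq (by ring)
    have hK0 : 0 ≤ K := zero_le_one.trans (le_max_left _ _)
    have hnn : 0 ≤ n * (‖v‖ * K) * R := by positivity
    have e1 : HasFDerivAt (firstJet Y) ((ContinuousLinearMap.pi fun γ =>
        fderiv ℝ (fun z => Y z γ) y).prod (ContinuousLinearMap.pi fun α =>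
        ContinuousLinearMap.pi fun γ => fderiv ℝ (pd α fun z => Y z γ) y)) y := by
      refine HasFDerivAt.prodMk (hasFDerivAt_pi.2 fun γ => ?_)
        (hasFDerivAt_pi.2 fun α => hasFDerivAt_pi.2 fun γ => ?_)
      · exact (differentiableAt_of_contDiffOn hU (hYs γ) hb.1).hasFDerivAt
      · exact (differentiableAt_of_contDiffOn hU (contDiffOn_pd hU (hYs γ) α) hb.1).hasFDerivAt
    rw [e1.fderiv]
    refine max_le ?_ ?_
    · exact (pi_norm_le_iff_of_nonneg hnn).2 fun γ => comp _ fun δ => r2' δ γ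
    · exact (pi_norm_le_iff_of_nonneg hnn).2 fun α => (pi_norm_le_iff_of_nonneg hnn).2 fun γ =>
        comp _ fun δ => r3' α γ δ
  -- Grönwall on the segment from `x₀` to `x`: the jet starts at zero and its derivative is bounded
  -- by a multiple of its norm.
  have hzero := eq_zero_of_abs_deriv_le_mul_abs_self_of_eq_zero_right
    (fun t ht => (hderiv t ht).continuousAt.continuousWithinAt)
    (fun t ht => (hderiv t (Set.Ico_subset_Icc_self ht)).hasDerivWithinAt)
    (by simpa using h0) hbound 1 (Set.right_mem_Icc.2 zero_le_one)
  simpa [hv] using hzero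

/-- A homothetic vector field on a connected set is determined by its first jet at a point. -/
lemma IsHomotheticOn.eq_zero_of_firstJet_eq_zero (hn : 0 < n) (hU : IsOpen U)
    (hUc : IsPreconnected U) (hg : IsMetricOn U g) {Y : (Fin n → ℝ) → Fin n → ℝ} {ψ : ℝ}
    (hY : IsHomotheticOn U g Y ψ) {x₀ : Fin n → ℝ} (hx₀ : x₀ ∈ U) (h0 : firstJet Y x₀ = 0) :
    ∀ x ∈ U, Y x = 0 := by
  have hY0 : Y x₀ = 0 := congrArg Prod.fst h0
  have hdY0 : ∀ α γ, pd α (fun y => Y y γ) x₀ = 0 := fun α γ =>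
    congrFun (congrFun (congrArg Prod.snd h0) α) γ
  obtain ⟨α, β, hαβ⟩ := hg.exists_ne_zero hn hx₀
  -- A zero first jet makes `L_Y g` vanish at `x₀`, where `g` has a nonzero entry; so the field is
  -- Killing.
  have hψ : ψ = 0 := by
    have := hY.lie_eq x₀ hx₀ α β
    simpa [lieMetric, hY0, hdY0, hαβ] using this.symm
  subst hψ
  -- The zero set of the first jet is open by the local uniqueness above and relatively closed by
  -- continuity.
  set V := {x | x ∈ U ∧ firstJet Y x = 0} with hV
  have hVo : IsOpen V := isOpen_iff_mem_nhds.2 fun x hx =>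
    Filter.Eventually.and (hU.mem_nhds hx.1) (hY.eventually_firstJet_eq_zero hU hg hx.1 hx.2)
  have hcl : closure V ∩ U ⊆ V := by
    rintro x ⟨hxV, hxU⟩
    refine ⟨hxU, ?_⟩
    have hc : ContinuousWithinAt (firstJet Y) V x :=
      ((contDiffOn_firstJet hU hY.smooth).continuousOn.continuousAt
        (hU.mem_nhds hxU)).continuousWithinAt
    have := hc.mem_closure_image hxV
    have hsub : firstJet Y '' V ⊆ {0} := by
      rintro _ ⟨y, hy, rfl⟩
      exact hy.2
    simpa using closure_mono hsub this
  intro x hx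
  exact congrArg Prod.fst
    (hUc.subset_of_closure_inter_subset hVo ⟨x₀, hx₀, hx₀, h0⟩ hcl hx).2

/-- The homothetic algebra, as a space of vector fields on `U`. -/
def homotheticAlgebra (hU : IsOpen U) (g : (Fin n → ℝ) → Matrix (Fin n) (Fin n) ℝ) :
    Submodule ℝ (U → Fin n → ℝ) where
  carrier := {f | ∃ Y ψ, IsHomotheticOn U g Y ψ ∧ U.domRestrict Y = f}
  zero_mem' := ⟨_, _, isHomotheticOn_zero, rfl⟩
  add_mem' := by
    rintro _ _ ⟨Y, ψ, hY, rfl⟩ ⟨Z, χ, hZ, rfl⟩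
    exact ⟨_, _, hY.add hU hZ, rfl⟩
  smul_mem' := by
    rintro c _ ⟨Y, ψ, hY, rfl⟩
    exact ⟨_, _, hY.smul hU c, rfl⟩

/-- Evaluating the first jet at one point is linear and injective, with values in a
finite-dimensional space. The chosen representatives `Y f` are additive and homogeneous in `f` only
on `U`, which is enough because `U` is open. -/
lemma finite_homotheticAlgebra (hn : 0 < n) (hU : IsOpen U) (hUc : IsConnected U)
    (hg : IsMetricOn U g) : Module.Finite ℝ (homotheticAlgebra hU g) := by
  obtain ⟨x₀, hx₀⟩ := hUc.nonempty
  choose Y ψ hY hYf using fun f : homotheticAlgebra hU g => f.2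
  have hval : ∀ (f : homotheticAlgebra hU g) (x : Fin n → ℝ) (hx : x ∈ U), Y f x = f.1 ⟨x, hx⟩ :=
    fun f x hx => congrFun (hYf f) ⟨x, hx⟩
  have D : ∀ f γ, DifferentiableAt ℝ (fun y => Y f y γ) x₀ := fun f γ =>
    differentiableAt_of_contDiffOn hU (contDiffOn_component (hY f).smooth γ) hx₀
  let ev : homotheticAlgebra hU g →ₗ[ℝ] (Fin n → ℝ) × (Fin n → Fin n → ℝ) :=
    { toFun := fun f => firstJet (Y f) x₀
      map_add' := fun f h => by
        refine Prod.ext ?_ (funext fun α => funext fun γ => ?_)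
        · simp [firstJet, hval _ _ hx₀]
        · have e : Set.EqOn (fun y => Y (f + h) y γ) (fun y => Y f y γ + Y h y γ) U :=
            fun y hy => by simp [hval _ _ hy]
          exact (dirDeriv_congr hU e _ hx₀).trans (dirDeriv_add (D f γ) (D h γ) _)
      map_smul' := fun c f => by
        refine Prod.ext ?_ (funext fun α => funext fun γ => ?_)
        · simp [firstJet, hval _ _ hx₀]
        · have e : Set.EqOn (fun y => Y (c • f) y γ) (fun y => c * Y f y γ) U :=
            fun y hy => by simp [hval _ _ hy]
          exact (dirDeriv_congr hU e _ hx₀).trans (dirDeriv_const_mul (D f γ) _ _) }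
  refine Module.Finite.of_injective ev ((injective_iff_map_eq_zero ev).2 fun f hf => ?_)
  refine Subtype.ext (funext fun x => ?_)
  rw [← hval f x x.2]
  exact (hY f).eq_zero_of_firstJet_eq_zero hn hU hUc.isPreconnected hg hx₀ hf x x.2

/-- The homothetic algebra is finite-dimensional, with a basis whose factors are `0` or `1`. -/
lemma exists_isHomotheticBasis (hn : 0 < n) (hU : IsOpen U) (hUc : IsConnected U)
    (hg : IsMetricOn U g) :
    ∃ (d : ℕ) (Y : Fin d → (Fin n → ℝ) → Fin n → ℝ) (ψ : Fin d → ℝ),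
      IsHomotheticBasis U g Y ψ ∧ ∀ I, ψ I = 0 ∨ ψ I = 1 := by
  have := finite_homotheticAlgebra hn hU hUc hg
  let e := Module.finBasis ℝ (homotheticAlgebra hU g)
  choose Y ψ hY hYf using fun I => (e I).2
  -- Dividing a basis field by its nonzero factor normalises that factor to 1.
  let w : Fin (Module.finrank ℝ (homotheticAlgebra hU g)) → ℝ :=
    fun I => if ψ I = 0 then 1 else (ψ I)⁻¹
  have hw : ∀ I, IsUnit (w I) := fun I => by
    by_cases h : ψ I = 0 <;> simp [w, h]
  let e' := e.isUnitSMul hw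
  have he' : ∀ I, U.domRestrict (fun x => w I • Y I x) = (e' I).1 := fun I => by
    rw [Module.Basis.isUnitSMul_apply]
    exact congrArg (w I • ·) (hYf I)
  refine ⟨_, fun I x => w I • Y I x, fun I => w I * ψ I, ⟨fun I => (hY I).smul hU (w I), ?_, ?_⟩,
    fun I => ?_⟩
  · have h := e'.linearIndependent.map' (homotheticAlgebra hU g).subtype
      (Submodule.ker_subtype _)
    simp only [he']
    exact h
  · intro Z χ hZ
    let z : homotheticAlgebra hU g := ⟨U.domRestrict Z, Z, χ, hZ, rfl⟩
    refine ⟨e'.repr z, fun x hx => ?_⟩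
    have h := congrArg (fun f : homotheticAlgebra hU g => f.1 ⟨x, hx⟩) (e'.sum_repr z)
    simp only [Submodule.coe_sum, Submodule.coe_smul, Finset.sum_apply, Pi.smul_apply, ← he'] at h
    exact h.symm
  · by_cases h : ψ I = 0 <;> simp [w, h]

/-- Compare both equations at a nonzero entry of `g`. This later identifies `½ ξ^t_{,t}` with `T^I
ψ_I`. -/
lemma IsHomotheticOn.factor_unique (hn : 0 < n) (hg : IsMetricOn U g) (hne : U.Nonempty)
    {Y : (Fin n → ℝ) → Fin n → ℝ} {ψ χ : ℝ} (hY : IsHomotheticOn U g Y ψ)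
    (hY' : IsHomotheticOn U g Y χ) : ψ = χ := by
  obtain ⟨x, hx⟩ := hne
  obtain ⟨α, β, h⟩ := hg.exists_ne_zero hn hx
  have := (hY.lie_eq x hx α β).symm.trans (hY'.lie_eq x hx α β)
  have := mul_right_cancel₀ h this
  linarith

end Homothetic

/-! ### Prolongation coefficients in terms of partial derivatives. -/

section Jets

variable {ι : Type} [Fintype ι] [DecidableEq ι]

/-- Partial derivative of a function of `(x, u)` with respect to `x_i`. -/
noncomputable def jx (i : ι) (F : Jet0 ι → ℝ) : Jet0 ι → ℝ := dirDeriv (Pi.single i 1, 0) F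

/-- Partial derivative of a function of `(x, u)` with respect to `u`. -/
noncomputable def ju (F : Jet0 ι → ℝ) : Jet0 ι → ℝ := dirDeriv (0, 1) F

/-- Total derivative of a function of `(x, u)`, in terms of partial derivatives. -/
noncomputable def tot (i : ι) (p : ι → ℝ) (F : Jet0 ι → ℝ) (w : Jet0 ι) : ℝ :=
  jx i F w + p i * ju F w

lemma fderiv_single_eq_tot (i : ι) (p : ι → ℝ) (F : Jet0 ι → ℝ) (w : Jet0 ι) :
    fderiv ℝ F w (Pi.single i 1, p i) = tot i p F w := by
  have : ((Pi.single i 1, p i) : Jet0 ι) = (Pi.single i 1, 0) + p i • (0, 1) := by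
    ext <;> simp
  rw [this, map_add, map_smul]
  rfl

lemma PointField.eta1_eq (X : PointField ι) (i : ι) : X.eta1 i = fun j : Jet1 ι =>
    (jx i X.η (j.1, j.2.1) + j.2.2 i * ju X.η (j.1, j.2.1))
      - ∑ k, j.2.2 k * (jx i (X.ξ k) (j.1, j.2.1) + j.2.2 i * ju (X.ξ k) (j.1, j.2.1)) := by
  funext j
  simp only [PointField.eta1, totalDeriv0, fderiv_single_eq_tot, tot]

/-- Directional derivatives of long jet expressions become one-variable derivatives along a line,
where every jet coordinate is affine in the parameter. -/
lemma fderiv_apply_eq_of_line {E : Type*} [NormedAddCommGroup E] [NormedSpace ℝ E] {G : E → ℝ}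
    {q v : E} (hG : DifferentiableAt ℝ G q) {c : ℝ}
    (h : HasDerivAt (fun s : ℝ => G (q + s • v)) c 0) : fderiv ℝ G q v = c := by
  have hl : HasDerivAt (fun s : ℝ => q + s • v) v 0 := by
    simpa using ((hasDerivAt_id (0 : ℝ)).smul_const v).const_add q
  have hG' : HasFDerivAt G (fderiv ℝ G q) (q + (0 : ℝ) • v) := by simpa using hG.hasFDerivAt
  exact (hG'.comp_hasDerivAt 0 hl).unique h

lemma hasDerivAt_line {E : Type*} [NormedAddCommGroup E] [NormedSpace ℝ E] {G : E → ℝ}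
    {q : E} (hG : DifferentiableAt ℝ G q) (v : E) :
    HasDerivAt (fun s : ℝ => G (q + s • v)) (fderiv ℝ G q v) 0 := by
  have hl : HasDerivAt (fun s : ℝ => q + s • v) v 0 := by
    simpa using ((hasDerivAt_id (0 : ℝ)).smul_const v).const_add q
  have hG' : HasFDerivAt G (fderiv ℝ G q) (q + (0 : ℝ) • v) := by simpa using hG.hasFDerivAt
  exact hG'.comp_hasDerivAt 0 hl

lemma hasDerivAt_coord (a b : ℝ) : HasDerivAt (fun s : ℝ => a + s * b) b 0 := by
  simpa using ((hasDerivAt_id (0 : ℝ)).mul_const b).const_add a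

/-- The part of the second prolongation coefficient that does not involve second derivatives
of `u`. -/
noncomputable def PointField.eta2Low (X : PointField ι) (i j : ι) (p : ι → ℝ) (w : Jet0 ι) : ℝ :=
  tot j p (jx i X.η) w + p i * tot j p (ju X.η) w
    - ∑ k, p k * (tot j p (jx i (X.ξ k)) w + p i * tot j p (ju (X.ξ k)) w)

/-- The second prolongation in terms of partial derivatives. -/
lemma PointField.eta2_eq {Ω : Set (Jet0 ι)} (hΩ : IsOpen Ω) {X : PointField ι}
    (hX : X.SmoothOn Ω) {x : ι → ℝ} {u : ℝ} (hw : (x, u) ∈ Ω) (p : ι → ℝ) (r : ι → ι → ℝ)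
    (i j : ι) :
    X.eta2 i j (x, u, p, r) = X.eta2Low i j p (x, u)
      + r j i * (ju X.η (x, u) - ∑ k, p k * ju (X.ξ k) (x, u))
      - ∑ k, (r j k * tot i p (X.ξ k) (x, u) + r k i * tot j p (X.ξ k) (x, u)) := by
  have D : ∀ {F : Jet0 ι → ℝ}, ContDiffOn ℝ ∞ F Ω → DifferentiableAt ℝ F (x, u) :=
    fun h => differentiableAt_of_contDiffOn hΩ h hw
  have hd : ∀ {F : Jet0 ι → ℝ}, ContDiffOn ℝ ∞ F Ω →
      DifferentiableAt ℝ (fun q : Jet1 ι => F (q.1, q.2.1)) (x, u, p) := fun {F} h =>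
    DifferentiableAt.comp (x, u, p) (g := F) (f := fun q : Jet1 ι => (q.1, q.2.1)) (D h)
      (by fun_prop)
  have hη1 := contDiffOn_dirDeriv hΩ hX.2 (Pi.single i 1, 0)
  have hη2 := contDiffOn_dirDeriv hΩ hX.2 (0, 1)
  have hξ1 := fun k => contDiffOn_dirDeriv hΩ (hX.1 k) (Pi.single i 1, 0)
  have hξ2 := fun k => contDiffOn_dirDeriv hΩ (hX.1 k) (0, 1)
  have hp : ∀ k, DifferentiableAt ℝ (fun q : Jet1 ι => q.2.2 k) (x, u, p) := fun k => by fun_prop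
  have hdiff : DifferentiableAt ℝ (X.eta1 i) (x, u, p) := by
    rw [X.eta1_eq]
    exact ((hd hη1).fun_add ((hp i).fun_mul (hd hη2))).fun_sub (DifferentiableAt.fun_sum fun k _ =>
      (hp k).fun_mul ((hd (hξ1 k)).fun_add ((hp i).fun_mul (hd (hξ2 k)))))
  have hF : ∀ {F : Jet0 ι → ℝ}, ContDiffOn ℝ ∞ F Ω →
      HasDerivAt (fun s : ℝ => F (x + s • Pi.single j 1, u + s * p j)) (tot j p F (x, u)) 0 := by
    intro F h
    have := hasDerivAt_line (D h) (Pi.single j 1, p j)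
    rwa [fderiv_single_eq_tot] at this
  -- Differentiation along `(e_j, p_j, r_j)`, the direction that defines the total derivative `D_j`.
  have h0 := ((hF hη1).fun_add ((hasDerivAt_coord (p i) (r j i)).fun_mul (hF hη2))).fun_sub
      (HasDerivAt.fun_sum (u := Finset.univ) fun k _ => (hasDerivAt_coord (p k) (r j k)).fun_mul
        ((hF (hξ1 k)).fun_add ((hasDerivAt_coord (p i) (r j i)).fun_mul (hF (hξ2 k)))))
  have hline := fderiv_apply_eq_of_line (v := (Pi.single j 1, p j, r j)) hdiff (by
    rw [X.eta1_eq]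
    exact h0)
  rw [PointField.eta2, totalDeriv1, hline]
  simp only [totalDeriv0, fderiv_single_eq_tot, zero_smul, add_zero, zero_mul,
    PointField.eta2Low, mul_add, mul_sub, Finset.sum_add_distrib, Finset.mul_sum]
  simp only [tot, jx, ju, mul_add, Finset.sum_add_distrib]
  have e : ∀ k, p k * (r j i * dirDeriv (0, 1) (X.ξ k) (x, u))
      = r j i * (p k * dirDeriv (0, 1) (X.ξ k) (x, u)) := fun k => by ring
  simp only [e]
  ring

end Jets

/-! ### The differential of the equation on the second jet space. -/

section Evolution

variable {n : ℕ} {U : Set (Fin n → ℝ)} {g : (Fin n → ℝ) → Matrix (Fin n) (Fin n) ℝ}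
  {C : (Fin n → ℝ) → Fin n → ℝ}

/-- The coefficient of `u_{,β}` in the evolution equation. -/
noncomputable def driftCoeff (g : (Fin n → ℝ) → Matrix (Fin n) (Fin n) ℝ)
    (C : (Fin n → ℝ) → Fin n → ℝ) (β : Fin n) (x : Fin n → ℝ) : ℝ :=
  laplacianDrift g x β - C x β

lemma contDiffOn_driftCoeff (hU : IsOpen U) (hg : IsMetricOn U g) (hC : ContDiffOn ℝ ∞ C U)
    (β : Fin n) : ContDiffOn ℝ ∞ (driftCoeff g C β) U :=
  (contDiffOn_laplacianDrift hU hg β).sub (contDiffOn_component hC β)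

lemma evolutionTheta_eq (q : Jet2 (Option (Fin n))) : evolutionTheta g C q
    = ∑ α, ∑ β, (g (space q.1))⁻¹ α β * q.2.2.2 (some α) (some β)
      + ∑ β, driftCoeff g C β (space q.1) * q.2.2.1 (some β) - q.2.2.1 none := by
  simp only [evolutionTheta, driftCoeff, sub_mul, Finset.sum_sub_distrib]
  ring

/-- The derivative of the left-hand side of the evolution equation on the second jet space. -/
lemma fderiv_evolutionTheta (hU : IsOpen U) (hg : IsMetricOn U g) (hC : ContDiffOn ℝ ∞ C U)
    {x : Option (Fin n) → ℝ} (hx : space x ∈ U) (u : ℝ) (p : Option (Fin n) → ℝ)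
    (r : Option (Fin n) → Option (Fin n) → ℝ) (v : Jet2 (Option (Fin n))) :
    fderiv ℝ (evolutionTheta g C) (x, u, p, r) v
      = ∑ α, ∑ β, ((∑ γ, v.1 (some γ) * pd γ (fun y => (g y)⁻¹ α β) (space x))
            * r (some α) (some β) + (g (space x))⁻¹ α β * v.2.2.2 (some α) (some β))
        + ∑ β, ((∑ γ, v.1 (some γ) * pd γ (driftCoeff g C β) (space x)) * p (some β)
            + driftCoeff g C β (space x) * v.2.2.1 (some β))
        - v.2.2.1 none := by
  have hB := contDiffOn_driftCoeff hU hg hC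
  have hs : DifferentiableAt ℝ (fun q : Jet2 (Option (Fin n)) => space q.1) (x, u, p, r) := by
    unfold space
    fun_prop
  have D : ∀ {F : (Fin n → ℝ) → ℝ}, ContDiffOn ℝ ∞ F U → DifferentiableAt ℝ F (space x) :=
    fun h => differentiableAt_of_contDiffOn hU h hx
  have hd : ∀ {F : (Fin n → ℝ) → ℝ}, ContDiffOn ℝ ∞ F U →
      DifferentiableAt ℝ (fun q : Jet2 (Option (Fin n)) => F (space q.1)) (x, u, p, r) :=
    fun {F} h => DifferentiableAt.comp (x, u, p, r) (g := F)
      (f := fun q : Jet2 (Option (Fin n)) => space q.1) (D h) hs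
  have hp : ∀ k, DifferentiableAt ℝ (fun q : Jet2 (Option (Fin n)) => q.2.2.1 k) (x, u, p, r) :=
    fun k => by fun_prop
  have hr : ∀ k l, DifferentiableAt ℝ (fun q : Jet2 (Option (Fin n)) => q.2.2.2 k l)
      (x, u, p, r) := fun k l => by fun_prop
  have hΘ : evolutionTheta g C = fun q => ∑ α, ∑ β, (g (space q.1))⁻¹ α β
      * q.2.2.2 (some α) (some β)
      + ∑ β, driftCoeff g C β (space q.1) * q.2.2.1 (some β) - q.2.2.1 none :=
    funext evolutionTheta_eq
  have hF : ∀ {F : (Fin n → ℝ) → ℝ}, ContDiffOn ℝ ∞ F U → HasDerivAt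
      (fun s : ℝ => F (space (x + s • v.1))) (∑ γ, v.1 (some γ) * pd γ F (space x)) 0 := by
    intro F h
    have := hasDerivAt_line (D h) (space v.1)
    rwa [dirDeriv_pi_eq_sum] at this
  rw [hΘ]
  refine (fderiv_apply_eq_of_line ?_
    (((HasDerivAt.fun_sum fun α _ => HasDerivAt.fun_sum fun β _ =>
      (hF (hg.contDiffOn_inv α β)).fun_mul
        (hasDerivAt_coord (r (some α) (some β)) (v.2.2.2 (some α) (some β)))).fun_add
      (HasDerivAt.fun_sum fun β _ => (hF (hB β)).fun_mul
        (hasDerivAt_coord (p (some β)) (v.2.2.1 (some β))))).fun_sub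
      (hasDerivAt_coord (p none) (v.2.2.1 none)))).trans ?_
  · exact ((DifferentiableAt.fun_sum fun α _ => DifferentiableAt.fun_sum fun β _ =>
      (hd (hg.contDiffOn_inv α β)).fun_mul (hr _ _)).fun_add
      (DifferentiableAt.fun_sum fun β _ => (hd (hB β)).fun_mul (hp _))).fun_sub (hp _)
  · simp only [zero_smul, add_zero, zero_mul]

end Evolution

/-! ### The symmetry condition and its splitting into determining equations. -/

section Determining

variable {n : ℕ} {J : Set ℝ} {U : Set (Fin n → ℝ)} {W : Set ℝ}
  {g : (Fin n → ℝ) → Matrix (Fin n) (Fin n) ℝ} {C : (Fin n → ℝ) → Fin n → ℝ}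
  {X : PointField (Option (Fin n))}

lemma isOpen_domain (hJ : IsOpen J) (hU : IsOpen U) (hW : IsOpen W) : IsOpen (domain J U W) := by
  have h1 : Continuous fun q : Jet0 (Option (Fin n)) => q.1 none := by fun_prop
  have h2 : Continuous fun q : Jet0 (Option (Fin n)) => space q.1 := by
    unfold space
    fun_prop
  exact (hJ.preimage h1).inter ((hU.preimage h2).inter (hW.preimage continuous_snd))

/-- The derivative of the inverse metric along a point field. -/
noncomputable def symbolDeriv (g : (Fin n → ℝ) → Matrix (Fin n) (Fin n) ℝ)
    (X : PointField (Option (Fin n))) (α β : Fin n) (w : Jet0 (Option (Fin n))) : ℝ :=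
  ∑ γ, X.ξ (some γ) w * pd γ (fun y => (g y)⁻¹ α β) (space w.1)

/-- The derivative of the drift along a point field. -/
noncomputable def driftDeriv (g : (Fin n → ℝ) → Matrix (Fin n) (Fin n) ℝ)
    (C : (Fin n → ℝ) → Fin n → ℝ) (X : PointField (Option (Fin n))) (β : Fin n)
    (w : Jet0 (Option (Fin n))) : ℝ :=
  ∑ γ, X.ξ (some γ) w * pd γ (driftCoeff g C β) (space w.1)

/-- The part of the symmetry condition that does not involve second derivatives of `u`. -/
noncomputable def lowPart (g : (Fin n → ℝ) → Matrix (Fin n) (Fin n) ℝ)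
    (C : (Fin n → ℝ) → Fin n → ℝ) (X : PointField (Option (Fin n))) (p : Option (Fin n) → ℝ)
    (w : Jet0 (Option (Fin n))) : ℝ :=
  ∑ α, ∑ β, (g (space w.1))⁻¹ α β * X.eta2Low (some α) (some β) p w
    + ∑ β, (driftDeriv g C X β w * p (some β) + driftCoeff g C β (space w.1) *
      (tot (some β) p X.η w - ∑ k, p k * tot (some β) p (X.ξ k) w))
    - (tot none p X.η w - ∑ k, p k * tot none p (X.ξ k) w)

/-- Makes the dependence on the second derivatives `r` explicit and linear, so that coefficients can
be compared. Symmetry of `r` allows its index pairs to be swapped. -/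
lemma fderiv_evolutionTheta_prolong (hJ : IsOpen J) (hU : IsOpen U) (hW : IsOpen W)
    (hg : IsMetricOn U g) (hC : ContDiffOn ℝ ∞ C U) (hX : X.SmoothOn (domain J U W))
    {x : Option (Fin n) → ℝ} {u : ℝ} (hw : (x, u) ∈ domain J U W) (p : Option (Fin n) → ℝ)
    {r : Option (Fin n) → Option (Fin n) → ℝ} (hr : ∀ i j, r i j = r j i) :
    fderiv ℝ (evolutionTheta g C) (x, u, p, r) (X.prolong (x, u, p, r))
      = lowPart g C X p (x, u) + ∑ α, ∑ β, symbolDeriv g X α β (x, u) * r (some α) (some β)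
        + (∑ α, ∑ β, (g (space x))⁻¹ α β * r (some α) (some β))
          * (ju X.η (x, u) - ∑ k, p k * ju (X.ξ k) (x, u))
        - ∑ α, ∑ β, (g (space x))⁻¹ α β * ∑ k, (r (some β) k * tot (some α) p (X.ξ k) (x, u)
          + r k (some α) * tot (some β) p (X.ξ k) (x, u)) := by
  have h1 : ∀ i, X.eta1 i (x, u, p) = tot i p X.η (x, u) - ∑ k, p k * tot i p (X.ξ k) (x, u) :=
    fun i => by rw [X.eta1_eq]; rfl
  have key : ∀ (A : Matrix (Fin n) (Fin n) ℝ) (S L K R : Fin n → Fin n → ℝ) (c : ℝ),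
      ∑ α, ∑ β, (S α β * R α β + A α β * (L α β + R α β * c - K α β))
        = ∑ α, ∑ β, A α β * L α β + ∑ α, ∑ β, S α β * R α β + (∑ α, ∑ β, A α β * R α β) * c
          - ∑ α, ∑ β, A α β * K α β := by
    intro A S L K R c
    simp only [Finset.sum_mul, ← Finset.sum_add_distrib, ← Finset.sum_sub_distrib]
    exact Finset.sum_congr rfl fun α _ => Finset.sum_congr rfl fun β _ => by ring
  have hswap : ∀ α β, r (some β) (some α) = r (some α) (some β) := fun α β => hr _ _
  rw [fderiv_evolutionTheta hU hg hC hw.2.1]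
  simp only [PointField.prolong, h1]
  rw [Finset.sum_congr rfl fun α _ => Finset.sum_congr rfl fun β _ => by
    rw [X.eta2_eq (isOpen_domain hJ hU hW) hX hw, hswap α β]]
  have k := key (g (space x))⁻¹ (fun α β => symbolDeriv g X α β (x, u))
    (fun α β => X.eta2Low (some α) (some β) p (x, u))
    (fun α β => ∑ k, (r (some β) k * tot (some α) p (X.ξ k) (x, u)
      + r k (some α) * tot (some β) p (X.ξ k) (x, u))) (fun α β => r (some α) (some β))
    (ju X.η (x, u) - ∑ k, p k * ju (X.ξ k) (x, u))
  simp only [symbolDeriv] at k ⊢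
  rw [k, lowPart]
  simp only [driftDeriv]
  ring

lemma eq_zero_of_sum_inv_mul (hg : IsMetricOn U g) {x : Fin n → ℝ} (hx : x ∈ U) {v : Fin n → ℝ}
    (h : ∀ δ, ∑ α, (g x)⁻¹ δ α * v α = 0) (α : Fin n) : v α = 0 := by
  have h0 : (g x)⁻¹.mulVec v = 0 := funext h
  have h1 := congrArg (g x).mulVec h0
  rw [Matrix.mulVec_mulVec, hg.mul_inv_cancel hx, Matrix.one_mulVec, Matrix.mulVec_zero] at h1
  exact congrFun h1 α

/-- A family of jet variables with given time and space entries. -/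
def jetVec (a : ℝ) (q : Fin n → ℝ) : Option (Fin n) → ℝ := fun o => o.elim a q

@[simp] lemma jetVec_none (a : ℝ) (q : Fin n → ℝ) : jetVec a q none = a := rfl

@[simp] lemma jetVec_some (a : ℝ) (q : Fin n → ℝ) (α : Fin n) : jetVec a q (some α) = q α := rfl

/-- For a symmetry, `ξ^t` depends on `t` only. -/
lemma IsLiePointSymmetry.time_component (hJ : IsOpen J) (hU : IsOpen U) (hW : IsOpen W)
    (hg : IsMetricOn U g) (hC : ContDiffOn ℝ ∞ C U) (hX : X.SmoothOn (domain J U W))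
    (hn : 0 < n) (h : IsLiePointSymmetry (evolutionTheta g C) (domain J U W) X)
    {w : Jet0 (Option (Fin n))} (hw : w ∈ domain J U W) :
    (∀ α, jx (some α) (X.ξ none) w = 0) ∧ ju (X.ξ none) w = 0 := by
  obtain ⟨x, u⟩ := w
  have key : ∀ (q : Fin n → ℝ) (a : ℝ) (α : Fin n),
      tot (some α) (jetVec a q) (X.ξ none) (x, u) = 0 := by
    intro q a
    -- The time entry of `p` solves the equation when all spatial second derivatives vanish. Mixed
    -- derivatives do not occur in it, so the jets with `r = 0` and with `u_{,tδ} = 1` both lie on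
    -- it; their two conditions differ by `2 g^{δα} D_α ξ^t`.
    set p := jetVec (∑ β, driftCoeff g C β (space x) * q β) q with hp
    refine eq_zero_of_sum_inv_mul hg hw.2.1 fun δ => ?_
    let r : Option (Fin n) → Option (Fin n) → ℝ := fun o o' =>
      o.elim (o'.elim 0 fun β => if β = δ then 1 else 0)
        fun α => o'.elim (if α = δ then 1 else 0) fun _ => 0
    have hr : ∀ i j, r i j = r j i := by
      rintro (_ | i) (_ | j) <;> rfl
    have e0 := h x u p 0 hw (fun _ _ => rfl) (by rw [evolutionTheta_eq]; simp [hp])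
    have e1 := h x u p r hw hr (by rw [evolutionTheta_eq]; simp [hp, r])
    rw [fderiv_evolutionTheta_prolong hJ hU hW hg hC hX hw p (fun _ _ => rfl)] at e0
    rw [fderiv_evolutionTheta_prolong hJ hU hW hg hC hX hw p hr] at e1
    simp [Fintype.sum_option, r] at e0 e1
    rw [e0, zero_sub, neg_eq_zero] at e1
    simp only [mul_add, mul_ite, mul_zero, Finset.sum_add_distrib, Finset.sum_ite_eq',
      Finset.mem_univ, if_true] at e1
    rw [Finset.sum_comm (f := fun α β => if α = δ then (g (space x))⁻¹ α β *
      tot (some β) p (X.ξ none) (x, u) else 0)] at e1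
    simp only [Finset.sum_ite_eq', Finset.mem_univ, if_true, hg.inv_symm hw.2.1 _ δ,
      ← two_mul] at e1
    exact (mul_eq_zero.1 e1).resolve_left two_ne_zero
  -- The total derivative is affine in `q`: `q = 0` yields the `x`-derivatives, then `q = 1` the
  -- `u`-derivative.
  have h0 : ∀ α, jx (some α) (X.ξ none) (x, u) = 0 := fun α => by
    simpa [tot] using key 0 0 α
  refine ⟨h0, ?_⟩
  simpa [tot, h0] using key 1 0 ⟨0, hn⟩

/-- The coefficients of the second derivatives of `u` in the symmetry condition. -/
noncomputable def symbolCond (g : (Fin n → ℝ) → Matrix (Fin n) (Fin n) ℝ)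
    (X : PointField (Option (Fin n))) (α β : Fin n) (p : Option (Fin n) → ℝ)
    (w : Jet0 (Option (Fin n))) : ℝ :=
  symbolDeriv g X α β w + jx none (X.ξ none) w * (g (space w.1))⁻¹ α β
    - ∑ γ, ((g (space w.1))⁻¹ γ α * tot (some γ) p (X.ξ (some β)) w
      + (g (space w.1))⁻¹ γ β * tot (some γ) p (X.ξ (some α)) w)

/-- The part of the symmetry condition that does not involve second derivatives of `u`, after
elimination of `u_{,t}`. -/
noncomputable def lowCond (g : (Fin n → ℝ) → Matrix (Fin n) (Fin n) ℝ)
    (C : (Fin n → ℝ) → Fin n → ℝ) (X : PointField (Option (Fin n))) (q : Fin n → ℝ)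
    (w : Jet0 (Option (Fin n))) : ℝ :=
  lowPart g C X (jetVec 0 q) w - (∑ β, driftCoeff g C β (space w.1) * q β)
    * (ju X.η w - jx none (X.ξ none) w - ∑ γ, q γ * ju (X.ξ (some γ)) w)

lemma sum_rotate {m : Type*} [Fintype m] (f : m → m → m → ℝ) :
    ∑ α, ∑ β, ∑ γ, f α β γ = ∑ α, ∑ β, ∑ γ, f γ α β := by
  rw [Finset.sum_congr rfl fun α _ => Finset.sum_comm, Finset.sum_comm,
    Finset.sum_congr rfl fun α _ => Finset.sum_comm]
  rw [Finset.sum_comm]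

/-- Relabelling indices exhibits the symmetrised coefficient of each `r α β`, in the shape used by
`symbolCond`. -/
lemma sum_symm_contract {m : Type*} [Fintype m] {A : Matrix m m ℝ} {r : m → m → ℝ}
    (hA : ∀ α β, A α β = A β α) (t : m → m → ℝ) :
    ∑ α, ∑ β, A α β * ∑ γ, (r β γ * t α γ + r γ α * t β γ)
      = ∑ α, ∑ β, (∑ γ, (A γ α * t γ β + A γ β * t γ α)) * r α β := by
  simp only [Finset.mul_sum, Finset.sum_mul, mul_add, add_mul, Finset.sum_add_distrib]
  congr 1
  · rw [sum_rotate]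
    exact Finset.sum_congr rfl fun α _ => Finset.sum_congr rfl fun β _ =>
      Finset.sum_congr rfl fun γ _ => by ring
  · rw [sum_rotate, sum_rotate]
    exact Finset.sum_congr rfl fun α _ => Finset.sum_congr rfl fun β _ =>
      Finset.sum_congr rfl fun γ _ => by rw [hA β γ]; ring

lemma tot_eq_zero {Ω : Set (Jet0 (Option (Fin n)))} (hΩ : IsOpen Ω)
    {F : Jet0 (Option (Fin n)) → ℝ} (hF : ∀ w ∈ Ω, F w = 0) {w : Jet0 (Option (Fin n))}
    (hw : w ∈ Ω) (i : Option (Fin n)) (p : Option (Fin n) → ℝ) : tot i p F w = 0 := by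
  have h : ∀ v, dirDeriv v F w = 0 := fun v => by
    rw [dirDeriv_congr hΩ (g := fun _ => 0) hF v hw, dirDeriv_const]
  simp [tot, jx, ju, h]

/-- The symmetry condition for a field whose `ξ^t` depends on `t` only. -/
lemma fderiv_evolutionTheta_prolong_of_time (hJ : IsOpen J) (hU : IsOpen U) (hW : IsOpen W)
    (hg : IsMetricOn U g) (hC : ContDiffOn ℝ ∞ C U) (hX : X.SmoothOn (domain J U W))
    (hτ : ∀ w ∈ domain J U W, (∀ α, jx (some α) (X.ξ none) w = 0) ∧ ju (X.ξ none) w = 0)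
    {x : Option (Fin n) → ℝ} {u : ℝ} (hw : (x, u) ∈ domain J U W) {p : Option (Fin n) → ℝ}
    {r : Option (Fin n) → Option (Fin n) → ℝ} (hr : ∀ i j, r i j = r j i)
    (h : evolutionTheta g C (x, u, p, r) = 0) :
    fderiv ℝ (evolutionTheta g C) (x, u, p, r) (X.prolong (x, u, p, r))
      = lowCond g C X (fun α => p (some α)) (x, u)
        + ∑ α, ∑ β, symbolCond g X α β p (x, u) * r (some α) (some β) := by
  have hΩ := isOpen_domain hJ hU hW
  have z1 : ∀ β α, tot (some β) p (jx (some α) (X.ξ none)) (x, u) = 0 := fun β α =>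
    tot_eq_zero hΩ (fun w hw => (hτ w hw).1 α) hw _ _
  have z2 : ∀ β, tot (some β) p (ju (X.ξ none)) (x, u) = 0 := fun β =>
    tot_eq_zero hΩ (fun w hw => (hτ w hw).2) hw _ _
  have z3 : ∀ i, tot (some i) p (X.ξ none) (x, u) = 0 := fun i => by
    simp [tot, (hτ _ hw).1, (hτ _ hw).2]
  have z4 : ju (X.ξ none) (x, u) = 0 := (hτ _ hw).2
  set q : Fin n → ℝ := fun α => p (some α) with hq
  have t1 : ∀ β F, tot (some β) (jetVec 0 q) F (x, u) = tot (some β) p F (x, u) :=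
    fun β F => rfl
  have elow : ∀ α β, X.eta2Low (some α) (some β) p (x, u)
      = X.eta2Low (some α) (some β) (jetVec 0 q) (x, u) := by
    intro α β
    simp only [PointField.eta2Low, Fintype.sum_option, t1, z1, z2, jetVec_some, jetVec_none]
    simp [hq]
  -- Since `ξ^t` depends on `t` only, `u_{,t}` drops out of `eta2Low` and enters `lowPart` linearly.
  have hlow : lowPart g C X p (x, u) = lowPart g C X (jetVec 0 q) (x, u)
      - p none * (ju X.η (x, u) - jx none (X.ξ none) (x, u)
        - ∑ γ, q γ * ju (X.ξ (some γ)) (x, u)) := by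
    have n1 : ∀ F, tot none p F (x, u) = jx none F (x, u) + p none * ju F (x, u) := fun F => rfl
    have n2 : ∀ F, tot none (jetVec 0 q) F (x, u) = jx none F (x, u) := fun F => by simp [tot]
    simp only [lowPart, elow, Fintype.sum_option, t1, z3, jetVec_some, jetVec_none, n1, n2, z4,
      mul_add, Finset.sum_add_distrib, mul_sub, Finset.mul_sum]
    have e : ∀ γ, p (some γ) * (p none * ju (X.ξ (some γ)) (x, u))
        = p none * (q γ * ju (X.ξ (some γ)) (x, u)) := fun γ => by
      rw [hq]; ring
    simp only [e]
    simp only [hq]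
    ring_nf
  -- The equation solved for `u_{,t}`: substituting it moves a multiple of `g^{αβ} u_{,αβ}` into the
  -- second-order coefficients.
  have hp : p none = ∑ α, ∑ β, (g (space x))⁻¹ α β * r (some α) (some β)
      + ∑ β, driftCoeff g C β (space x) * q β := by
    rw [evolutionTheta_eq] at h
    exact (sub_eq_zero.1 h).symm
  rw [fderiv_evolutionTheta_prolong hJ hU hW hg hC hX hw p hr, hlow, hp]
  have hcontr := sum_symm_contract (r := fun α β => r (some α) (some β)) (hg.inv_symm hw.2.1)
    (fun α γ => tot (some α) p (X.ξ (some γ)) (x, u))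
  simp only [Fintype.sum_option, z3, z4, mul_zero, zero_add, add_zero] at hcontr ⊢
  rw [hcontr]
  have key : ∀ (A : Matrix (Fin n) (Fin n) ℝ) (S T R : Fin n → Fin n → ℝ) (c : ℝ),
      ∑ α, ∑ β, (S α β + c * A α β - T α β) * R α β
        = ∑ α, ∑ β, S α β * R α β + c * ∑ α, ∑ β, A α β * R α β - ∑ α, ∑ β, T α β * R α β := by
    intro A S T R c
    simp only [Finset.mul_sum, ← Finset.sum_add_distrib, ← Finset.sum_sub_distrib]
    exact Finset.sum_congr rfl fun α _ => Finset.sum_congr rfl fun β _ => by ring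
  simp only [symbolCond]
  rw [key, lowCond]
  simp only [hq]
  ring

/-- The symmetrised matrix unit at `(α, β)` as test matrix returns `2 M α β`, also on the diagonal.
-/
lemma eq_zero_of_sum_symm {m : Type*} [Fintype m] [DecidableEq m] {M : m → m → ℝ}
    (hM : ∀ α β, M α β = M β α)
    (h : ∀ r : m → m → ℝ, (∀ α β, r α β = r β α) → ∑ α, ∑ β, M α β * r α β = 0) (α β : m) :
    M α β = 0 := by
  have := h (fun μ ν => (if μ = α then if ν = β then 1 else 0 else 0)
    + (if ν = α then if μ = β then 1 else 0 else 0)) (fun μ ν => by rw [add_comm])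
  simp only [mul_add, Finset.sum_add_distrib, mul_ite, mul_one, mul_zero] at this
  rw [Finset.sum_comm (f := fun μ ν => if ν = α then if μ = β then M μ ν else 0 else 0)] at this
  simp at this
  rw [hM β α] at this
  linarith

/-- Symmetric second derivatives detect only the symmetric part of their coefficients, so this is
needed before each coefficient can be set to zero. -/
lemma symbolCond_symm (hU : IsOpen U) (hg : IsMetricOn U g) {w : Jet0 (Option (Fin n))} (hw : space w.1 ∈ U)
    (α β : Fin n) (p : Option (Fin n) → ℝ) : symbolCond g X α β p w = symbolCond g X β α p w := by
  have h1 : symbolDeriv g X α β w = symbolDeriv g X β α w := by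
    refine Finset.sum_congr rfl fun γ _ => ?_
    congr 1
    exact dirDeriv_congr hU (fun y hy => hg.inv_symm hy α β) _ hw
  unfold symbolCond
  rw [h1, hg.inv_symm hw α β]
  congr 1
  exact Finset.sum_congr rfl fun γ _ => add_comm _ _

/-- Sorting by degree in `q = (u_{,α})`. Here `e1`, `e2` stand for the first and second
`x`-derivatives of `η`, `eu` for those of `η_{,u}`, `x1`, `x2` for those of `ξ^γ`, `B` and `dB` for
the drift and its derivative along the field, and `τ'` for `ξ^t_{,t}`. -/
lemma low_identity {m : Type*} [Fintype m] {A : Matrix m m ℝ} (hA : ∀ α β, A α β = A β α)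
    (e2 x1 : m → m → ℝ) (eu e1 B dB q ξt : m → ℝ) (x2 : m → m → m → ℝ) (ηu ηuu ηt τ' : ℝ) :
    ∑ α, ∑ β, A α β * (e2 α β + q β * eu α + q α * (eu β + q β * ηuu) - ∑ γ, q γ * x2 α β γ)
      + ∑ β, (dB β * q β + B β * (e1 β + q β * ηu - ∑ γ, q γ * x1 β γ))
      - (ηt - ∑ γ, q γ * ξt γ) - (∑ β, B β * q β) * (ηu - τ')
    = (∑ α, ∑ β, A α β * e2 α β + ∑ β, B β * e1 β - ηt)
      + ∑ δ, q δ * (2 * ∑ α, A α δ * eu α - ∑ α, ∑ β, A α β * x2 α β δ + dB δ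
        - ∑ β, B β * x1 β δ + B δ * τ' + ξt δ)
      + ηuu * ∑ α, ∑ β, A α β * (q α * q β) := by
  have i1 : ∑ δ, q δ * (2 * ∑ α, A α δ * eu α)
      = ∑ α, ∑ β, A α β * (q β * eu α) + ∑ α, ∑ β, A α β * (q α * eu β) := by
    have c1 : ∑ α, ∑ β, A α β * (q β * eu α) = ∑ δ, q δ * ∑ α, A α δ * eu α := by
      rw [Finset.sum_comm]
      simp only [Finset.mul_sum]
      exact Finset.sum_congr rfl fun δ _ => Finset.sum_congr rfl fun α _ => by ring
    have c2 : ∑ α, ∑ β, A α β * (q α * eu β) = ∑ δ, q δ * ∑ α, A α δ * eu α := by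
      simp only [Finset.mul_sum]
      exact Finset.sum_congr rfl fun δ _ => Finset.sum_congr rfl fun α _ => by rw [hA δ α]; ring
    rw [c1, c2, ← Finset.sum_add_distrib]
    exact Finset.sum_congr rfl fun δ _ => by ring
  have i2 : ∑ δ, q δ * ∑ α, ∑ β, A α β * x2 α β δ
      = ∑ α, ∑ β, A α β * ∑ γ, q γ * x2 α β γ := by
    simp only [Finset.mul_sum]
    rw [sum_rotate]
    exact Finset.sum_congr rfl fun δ _ => Finset.sum_congr rfl fun α _ =>
      Finset.sum_congr rfl fun α _ => by ring
  have i3 : ∑ δ, q δ * ∑ β, B β * x1 β δ = ∑ β, B β * ∑ γ, q γ * x1 β γ := by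
    simp only [Finset.mul_sum]
    rw [Finset.sum_comm]
    exact Finset.sum_congr rfl fun δ _ => Finset.sum_congr rfl fun α _ => by ring
  have i4 : ∑ α, ∑ β, A α β * (q α * (q β * ηuu)) = ηuu * ∑ α, ∑ β, A α β * (q α * q β) := by
    simp only [Finset.mul_sum]
    exact Finset.sum_congr rfl fun δ _ => Finset.sum_congr rfl fun α _ => by ring
  have i5 : ∑ δ, q δ * dB δ = ∑ β, dB β * q β := Finset.sum_congr rfl fun δ _ => mul_comm _ _
  have i6 : ∑ δ, q δ * (B δ * τ') = (∑ β, B β * q β) * τ' := by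
    rw [Finset.sum_mul]
    exact Finset.sum_congr rfl fun δ _ => by ring
  have i7 : ∑ β, B β * (q β * ηu) = (∑ β, B β * q β) * ηu := by
    rw [Finset.sum_mul]
    exact Finset.sum_congr rfl fun δ _ => by ring
  simp only [mul_add, mul_sub, Finset.sum_add_distrib, Finset.sum_sub_distrib, i1, i2, i3, i4, i5,
    i6, i7]
  ring

/-- The coefficient of `u_{,δ}` in the symmetry condition. -/
noncomputable def firstOrderCond (g : (Fin n → ℝ) → Matrix (Fin n) (Fin n) ℝ)
    (C : (Fin n → ℝ) → Fin n → ℝ) (X : PointField (Option (Fin n))) (δ : Fin n)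
    (w : Jet0 (Option (Fin n))) : ℝ :=
  2 * ∑ α, (g (space w.1))⁻¹ α δ * jx (some α) (ju X.η) w
    - ∑ α, ∑ β, (g (space w.1))⁻¹ α β * jx (some β) (jx (some α) (X.ξ (some δ))) w
    + driftDeriv g C X δ w - ∑ β, driftCoeff g C β (space w.1) * jx (some β) (X.ξ (some δ)) w
    + driftCoeff g C δ (space w.1) * jx none (X.ξ none) w + jx none (X.ξ (some δ)) w

/-- The evolution operator applied to `η` at fixed `u`. -/
noncomputable def zeroOrderCond (g : (Fin n → ℝ) → Matrix (Fin n) (Fin n) ℝ)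
    (C : (Fin n → ℝ) → Fin n → ℝ) (X : PointField (Option (Fin n)))
    (w : Jet0 (Option (Fin n))) : ℝ :=
  ∑ α, ∑ β, (g (space w.1))⁻¹ α β * jx (some β) (jx (some α) X.η) w
    + ∑ β, driftCoeff g C β (space w.1) * jx (some β) X.η w - jx none X.η w

/-- Once `ξ^γ` does not depend on `u`, the cubic terms in `q` are gone and the three coefficients of
`low_identity` are the remaining determining equations. -/
lemma lowCond_eq (hΩ : IsOpen (domain J U W)) (hg : IsMetricOn U g)
    (hX : X.SmoothOn (domain J U W))
    (hξ : ∀ w ∈ domain J U W, ∀ γ, ju (X.ξ (some γ)) w = 0)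
    {w : Jet0 (Option (Fin n))} (hw : w ∈ domain J U W) (q : Fin n → ℝ) :
    lowCond g C X q w = zeroOrderCond g C X w + ∑ δ, q δ * firstOrderCond g C X δ w
      + ju (ju X.η) w * ∑ α, ∑ β, (g (space w.1))⁻¹ α β * (q α * q β) := by
  have z0 : ∀ γ, ju (X.ξ (some γ)) w = 0 := hξ w hw
  have z1 : ∀ β γ, tot (some β) (jetVec 0 q) (ju (X.ξ (some γ))) w = 0 := fun β γ =>
    tot_eq_zero hΩ (fun w hw => hξ w hw γ) hw _ _
  have z2 : ∀ α γ, ju (jx (some α) (X.ξ (some γ))) w = 0 := fun α γ => by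
    have h := tot_eq_zero hΩ (fun w hw => hξ w hw γ) hw (some α) 0
    have h' : jx (some α) (ju (X.ξ (some γ))) w = 0 := by simpa [tot] using h
    exact (dirDeriv_comm hΩ (hX.1 (some γ)) _ _ hw).trans h'
  have z3 : ∀ α, ju (jx (some α) X.η) w = jx (some α) (ju X.η) w := fun α =>
    dirDeriv_comm hΩ hX.2 _ _ hw
  have n2 : ∀ F, tot none (jetVec 0 q) F w = jx none F w := fun F => by simp [tot]
  have t1 : ∀ β F, tot (some β) (jetVec 0 q) F w = jx (some β) F w + q β * ju F w :=
    fun β F => rfl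
  have h := low_identity (hg.inv_symm hw.2.1)
    (fun α β => jx (some β) (jx (some α) X.η) w) (fun β γ => jx (some β) (X.ξ (some γ)) w)
    (fun α => jx (some α) (ju X.η) w) (fun β => jx (some β) X.η w)
    (fun β => driftCoeff g C β (space w.1)) (fun β => driftDeriv g C X β w) q
    (fun γ => jx none (X.ξ (some γ)) w) (fun α β γ => jx (some β) (jx (some α) (X.ξ (some γ))) w)
    (ju X.η w) (ju (ju X.η) w) (jx none X.η w) (jx none (X.ξ none) w)
  unfold zeroOrderCond firstOrderCond
  rw [← h]
  simp only [lowCond, lowPart, PointField.eta2Low, Fintype.sum_option, jetVec_none, jetVec_some,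
    n2, z1, zero_mul, zero_add]
  simp only [t1, z0, z2, z3, mul_zero, add_zero, Finset.sum_const_zero, sub_zero]

/-- The determining equations of the symmetries of the evolution equation, at a point. -/
structure DeterminingEquations (g : (Fin n → ℝ) → Matrix (Fin n) (Fin n) ℝ)
    (C : (Fin n → ℝ) → Fin n → ℝ) (X : PointField (Option (Fin n)))
    (w : Jet0 (Option (Fin n))) : Prop where
  time_x : ∀ α, jx (some α) (X.ξ none) w = 0
  time_u : ju (X.ξ none) w = 0
  space_u : ∀ γ, ju (X.ξ (some γ)) w = 0
  eta_uu : ju (ju X.η) w = 0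
  symbol : ∀ α β, symbolCond g X α β 0 w = 0
  first : ∀ δ, firstOrderCond g C X δ w = 0
  zero : zeroOrderCond g C X w = 0

/-- The second-order coefficient is required only at `p = 0`: when `ξ^γ_{,u} = 0`, it does not
depend on `p`. -/
lemma isLiePointSymmetry_of_determining (hJ : IsOpen J) (hU : IsOpen U) (hW : IsOpen W)
    (hg : IsMetricOn U g) (hC : ContDiffOn ℝ ∞ C U) (hX : X.SmoothOn (domain J U W))
    (h : ∀ w ∈ domain J U W, DeterminingEquations g C X w) :
    IsLiePointSymmetry (evolutionTheta g C) (domain J U W) X := by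
  intro x u p r hw hr hΘ
  have hsym : ∀ α β, symbolCond g X α β p (x, u) = 0 := fun α β => by
    rw [← (h _ hw).symbol α β]
    simp [symbolCond, tot, (h _ hw).space_u]
  rw [fderiv_evolutionTheta_prolong_of_time hJ hU hW hg hC hX
    (fun w hw => ⟨(h w hw).time_x, (h w hw).time_u⟩) hw hr hΘ,
    lowCond_eq (isOpen_domain hJ hU hW) hg hX (fun w hw => (h w hw).space_u) hw]
  simp [hsym, (h _ hw).eta_uu, (h _ hw).first, (h _ hw).zero]

lemma exists_inv_ne_zero (hn : 0 < n) (hg : IsMetricOn U g) {x : Fin n → ℝ} (hx : x ∈ U) :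
    ∃ α β, (g x)⁻¹ α β ≠ 0 := by
  by_contra! h
  obtain ⟨α, β, hαβ⟩ := hg.exists_ne_zero hn hx
  have h0 : (g x)⁻¹ = 0 := Matrix.ext h
  have h1 := hg.mul_inv_cancel hx
  rw [h0, mul_zero] at h1
  have h2 : g x = 0 := by rw [← mul_one (g x), ← h1, mul_zero]
  exact hαβ (by rw [h2]; rfl)

/-- Any `q` and symmetric `ρ` extend to a jet on the equation by solving for `u_{,t}`, so `base` is
a polynomial identity in independent variables: first its part linear in `ρ` is split off, then the
powers of `q`. -/
lemma IsLiePointSymmetry.determining (hn : 0 < n) (hJ : IsOpen J) (hU : IsOpen U) (hW : IsOpen W)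
    (hg : IsMetricOn U g) (hC : ContDiffOn ℝ ∞ C U) (hX : X.SmoothOn (domain J U W))
    (h : IsLiePointSymmetry (evolutionTheta g C) (domain J U W) X)
    {w : Jet0 (Option (Fin n))} (hw : w ∈ domain J U W) : DeterminingEquations g C X w := by
  have hτ := fun w (hw : w ∈ domain J U W) => h.time_component hJ hU hW hg hC hX hn hw
  have base : ∀ w ∈ domain J U W, ∀ (q : Fin n → ℝ) (ρ : Fin n → Fin n → ℝ),
      (∀ α β, ρ α β = ρ β α) →
      lowCond g C X q w + ∑ α, ∑ β, symbolCond g X α β (jetVec 0 q) w * ρ α β = 0 := by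
    rintro ⟨x, u⟩ hw q ρ hρ
    let p : Option (Fin n) → ℝ := jetVec (∑ α, ∑ β, (g (space x))⁻¹ α β * ρ α β
      + ∑ β, driftCoeff g C β (space x) * q β) q
    let r : Option (Fin n) → Option (Fin n) → ℝ := fun o o' =>
      o.elim 0 fun α => o'.elim 0 fun β => ρ α β
    have hr : ∀ i j, r i j = r j i := by
      rintro (_ | i) (_ | j)
      · rfl
      · rfl
      · rfl
      · exact hρ i j
    have hΘ : evolutionTheta g C (x, u, p, r) = 0 := by
      rw [evolutionTheta_eq]
      simp [p, r]
    rw [← h x u p r hw hr hΘ,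
      fderiv_evolutionTheta_prolong_of_time hJ hU hW hg hC hX hτ hw hr hΘ]
    rfl
  have hlow : ∀ w ∈ domain J U W, ∀ q, lowCond g C X q w = 0 := fun w hw q => by
    simpa using base w hw q 0 fun _ _ => rfl
  have hsym : ∀ w ∈ domain J U W, ∀ q α β, symbolCond g X α β (jetVec 0 q) w = 0 := by
    intro w hw q
    refine eq_zero_of_sum_symm (fun α β => symbolCond_symm hU hg hw.2.1 α β _) fun r hr => ?_
    simpa [hlow w hw q] using base w hw q r hr
  have hjet0 : jetVec 0 (0 : Fin n → ℝ) = 0 := by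
    funext o
    cases o <;> rfl
  have hsym0 : ∀ w ∈ domain J U W, ∀ α β, symbolCond g X α β 0 w = 0 := fun w hw α β => by
    rw [← hjet0]
    exact hsym w hw 0 α β
  have hξ : ∀ w ∈ domain J U W, ∀ γ, ju (X.ξ (some γ)) w = 0 := by
    intro w hw γ
    -- With `q_δ = g_{γδ}` the contraction `g^{δγ} q_δ` equals 1, so subtracting the condition at `q
    -- = 0` leaves `2 ξ^γ_{,u} = 0`.
    have h1 := hsym w hw (fun δ => g (space w.1) γ δ) γ γ
    rw [← hsym0 w hw γ γ] at h1
    simp only [symbolCond, tot, jetVec_some, Pi.zero_apply, zero_mul, add_zero, mul_add,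
      Finset.sum_add_distrib] at h1
    have h2 : ∑ δ, (g (space w.1))⁻¹ δ γ * (g (space w.1) γ δ * ju (X.ξ (some γ)) w)
        = ju (X.ξ (some γ)) w := by
      have h3 := congrFun (congrFun (hg.mul_inv_cancel hw.2.1) γ) γ
      rw [Matrix.mul_apply, Matrix.one_apply_eq] at h3
      have h4 := congrArg (· * ju (X.ξ (some γ)) w) h3
      simp only [Finset.sum_mul, one_mul] at h4
      rw [← h4]
      refine Finset.sum_congr rfl fun δ _ => ?_
      rw [h4]
      ring
    rw [h2] at h1
    linarith
  have hpoly : ∀ q : Fin n → ℝ, zeroOrderCond g C X w + ∑ δ, q δ * firstOrderCond g C X δ w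
      + ju (ju X.η) w * ∑ α, ∑ β, (g (space w.1))⁻¹ α β * (q α * q β) = 0 := fun q => by
    rw [← lowCond_eq (isOpen_domain hJ hU hW) hg hX hξ hw, hlow w hw]
  have hzero : zeroOrderCond g C X w = 0 := by simpa using hpoly 0
  -- The even part in `q`, the constant term being zero already.
  have hquad : ∀ q : Fin n → ℝ,
      ju (ju X.η) w * ∑ α, ∑ β, (g (space w.1))⁻¹ α β * (q α * q β) = 0 := by
    intro q
    have h1 := hpoly q
    have h2 := hpoly (-q)
    simp only [Pi.neg_apply, neg_mul, mul_neg, neg_neg, Finset.sum_neg_distrib] at h2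
    linarith
  have huu : ju (ju X.η) w = 0 := by
    by_contra hne
    obtain ⟨μ, ν, hμν⟩ := exists_inv_ne_zero hn hg hw.2.1
    have hq := fun q => (mul_eq_zero.1 (hquad q)).resolve_left hne
    -- Polarisation: a quadratic form that vanishes on all vectors has zero matrix, contradicting
    -- `g^{μν} ≠ 0`.
    have h1 := hq (Pi.single μ 1 + Pi.single ν 1)
    simp only [Pi.add_apply, add_mul, mul_add, Finset.sum_add_distrib, hq] at h1
    simp [Pi.single_apply, hg.inv_symm hw.2.1 ν μ, hμν] at h1
  refine ⟨(hτ w hw).1, (hτ w hw).2, hξ w hw, huu, hsym0 w hw, fun δ => ?_, hzero⟩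
  have h1 := hpoly (Pi.single δ 1)
  rw [hzero, huu] at h1
  simpa [Pi.single_apply] using h1

end Determining

/-! ### Determining equations read on slices at fixed `t` or `u`. -/

section Slices

variable {n : ℕ} {J : Set ℝ} {U : Set (Fin n → ℝ)} {W : Set ℝ}
  {g : (Fin n → ℝ) → Matrix (Fin n) (Fin n) ℝ} {C : (Fin n → ℝ) → Fin n → ℝ}
  {X : PointField (Option (Fin n))}

lemma contDiffOn_jx {Ω : Set (Jet0 (Option (Fin n)))} (hΩ : IsOpen Ω)
    {F : Jet0 (Option (Fin n)) → ℝ} (hF : ContDiffOn ℝ ∞ F Ω) (i : Option (Fin n)) :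
    ContDiffOn ℝ ∞ (jx i F) Ω := contDiffOn_dirDeriv hΩ hF _

lemma contDiffOn_ju {Ω : Set (Jet0 (Option (Fin n)))} (hΩ : IsOpen Ω)
    {F : Jet0 (Option (Fin n)) → ℝ} (hF : ContDiffOn ℝ ∞ F Ω) :
    ContDiffOn ℝ ∞ (ju F) Ω := contDiffOn_dirDeriv hΩ hF _

lemma jetVec_space (z : Option (Fin n) → ℝ) : jetVec (z none) (space z) = z := by
  funext o
  cases o <;> rfl

lemma jetVec_mem_domain {t u : ℝ} {x : Fin n → ℝ} (ht : t ∈ J) (hx : x ∈ U) (hu : u ∈ W) :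
    (jetVec t x, u) ∈ domain J U W := ⟨ht, hx, hu⟩

lemma contDiff_jetVec : ContDiff ℝ ∞ fun q : ℝ × (Fin n → ℝ) => jetVec q.1 q.2 := by
  refine contDiff_pi.2 fun o => ?_
  cases o with
  | none => exact contDiff_fst
  | some α => exact (contDiff_apply ℝ ℝ α).comp contDiff_snd

lemma contDiffOn_slice {F : Jet0 (Option (Fin n)) → ℝ} (hF : ContDiffOn ℝ ∞ F (domain J U W))
    {u : ℝ} (hu : u ∈ W) :
    ContDiffOn ℝ ∞ (fun q : ℝ × (Fin n → ℝ) => F (jetVec q.1 q.2, u)) (J ×ˢ U) :=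
  hF.comp (contDiff_jetVec.prodMk contDiff_const).contDiffOn fun _ hq => ⟨hq.1, hq.2, hu⟩

lemma contDiffOn_space_slice {v : ℝ → (Fin n → ℝ) → ℝ}
    (hv : ContDiffOn ℝ ∞ (fun q : ℝ × (Fin n → ℝ) => v q.1 q.2) (J ×ˢ U)) {t : ℝ} (ht : t ∈ J) :
    ContDiffOn ℝ ∞ (v t) U :=
  hv.comp (contDiff_const.prodMk contDiff_id).contDiffOn fun _ hx => ⟨ht, hx⟩

lemma contDiffOn_time_slice {v : ℝ → (Fin n → ℝ) → ℝ}
    (hv : ContDiffOn ℝ ∞ (fun q : ℝ × (Fin n → ℝ) => v q.1 q.2) (J ×ˢ U)) {x : Fin n → ℝ}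
    (hx : x ∈ U) : ContDiffOn ℝ ∞ (fun s => v s x) J :=
  hv.comp (contDiff_id.prodMk contDiff_const).contDiffOn fun _ ht => ⟨ht, hx⟩

lemma pd_slice (hJ : IsOpen J) (hU : IsOpen U) (hW : IsOpen W) {F : Jet0 (Option (Fin n)) → ℝ}
    (hF : ContDiffOn ℝ ∞ F (domain J U W)) {t u : ℝ} {x : Fin n → ℝ} (ht : t ∈ J) (hx : x ∈ U)
    (hu : u ∈ W) (α : Fin n) :
    pd α (fun y => F (jetVec t y, u)) x = jx (some α) F (jetVec t x, u) := by
  have hw : (jetVec t x, u) ∈ domain J U W := ⟨ht, hx, hu⟩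
  refine fderiv_apply_eq_of_line (differentiableAt_of_contDiffOn hU
    (contDiffOn_space_slice (v := fun s y => F (jetVec s y, u)) (contDiffOn_slice hF hu) ht)
    hx) ?_
  have h := hasDerivAt_line (differentiableAt_of_contDiffOn (isOpen_domain hJ hU hW) hF hw)
    (Pi.single (some α) 1, 0)
  have e : ∀ s : ℝ, (jetVec t (x + s • Pi.single α 1), u)
      = (jetVec t x, u) + s • ((Pi.single (some α) 1, 0) : Jet0 (Option (Fin n))) := by
    intro s
    refine Prod.ext (funext fun o => ?_) (by simp)
    cases o <;> simp [Pi.single_apply]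
  simp only [e]
  exact h

lemma hasDerivAt_time_slice (hJ : IsOpen J) (hU : IsOpen U) (hW : IsOpen W)
    {F : Jet0 (Option (Fin n)) → ℝ} (hF : ContDiffOn ℝ ∞ F (domain J U W)) {t u : ℝ}
    {x : Fin n → ℝ} (ht : t ∈ J) (hx : x ∈ U) (hu : u ∈ W) :
    HasDerivAt (fun s => F (jetVec s x, u)) (jx none F (jetVec t x, u)) t := by
  have hw : (jetVec t x, u) ∈ domain J U W := ⟨ht, hx, hu⟩
  have h := hasDerivAt_line (differentiableAt_of_contDiffOn (isOpen_domain hJ hU hW) hF hw)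
    (Pi.single none 1, 0)
  have h' : HasDerivAt (fun s : ℝ => F ((jetVec t x, u) +
      s • ((Pi.single none 1, 0) : Jet0 (Option (Fin n))))) (jx none F (jetVec t x, u)) (t - t) := by
    rw [sub_self]
    exact h
  have h2 := h'.comp_sub_const t t
  have e : ∀ s : ℝ, (jetVec t x, u) + (s - t) • ((Pi.single none 1, 0) : Jet0 (Option (Fin n)))
      = (jetVec s x, u) := by
    intro s
    refine Prod.ext (funext fun o => ?_) (by simp)
    cases o <;> simp
  simpa only [e] using h2

lemma hasDerivAt_u_slice {Ω : Set (Jet0 (Option (Fin n)))} (hΩ : IsOpen Ω)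
    {F : Jet0 (Option (Fin n)) → ℝ} (hF : ContDiffOn ℝ ∞ F Ω) {z : Option (Fin n) → ℝ} {u : ℝ}
    (hw : (z, u) ∈ Ω) : HasDerivAt (fun v => F (z, v)) (ju F (z, u)) u := by
  have hl : HasDerivAt (fun v : ℝ => ((z, v) : Jet0 (Option (Fin n)))) (0, 1) u :=
    (hasDerivAt_const u z).prodMk (hasDerivAt_id u)
  exact (differentiableAt_of_contDiffOn hΩ hF hw).hasFDerivAt.comp_hasDerivAt u hl

lemma eq_of_ju_eq_zero (hJ : IsOpen J) (hU : IsOpen U) (hW : IsOpen W) (hWc : W.OrdConnected)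
    {F : Jet0 (Option (Fin n)) → ℝ} (hF : ContDiffOn ℝ ∞ F (domain J U W))
    (h0 : ∀ w ∈ domain J U W, ju F w = 0) {z : Option (Fin n) → ℝ} {u v : ℝ}
    (hu : (z, u) ∈ domain J U W) (hv : (z, v) ∈ domain J U W) : F (z, u) = F (z, v) := by
  have hd : ∀ s ∈ W, HasDerivAt (fun v => F (z, v)) 0 s := fun s hs => by
    have hw : (z, s) ∈ domain J U W := ⟨hu.1, hu.2.1, hs⟩
    have h := hasDerivAt_u_slice (isOpen_domain hJ hU hW) hF hw
    rwa [h0 _ hw] at h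
  exact hW.is_const_of_deriv_eq_zero hWc.isPreconnected
    (fun s hs => (hd s hs).differentiableAt.differentiableWithinAt)
    (fun s hs => (hd s hs).deriv) hu.2.2 hv.2.2

lemma eq_of_jx_some_eq_zero (hJ : IsOpen J) (hU : IsOpen U) (hUc : IsPreconnected U)
    (hW : IsOpen W) {F : Jet0 (Option (Fin n)) → ℝ} (hF : ContDiffOn ℝ ∞ F (domain J U W))
    (h0 : ∀ w ∈ domain J U W, ∀ α, jx (some α) F w = 0) {t u : ℝ} {x y : Fin n → ℝ}
    (ht : t ∈ J) (hx : x ∈ U) (hy : y ∈ U) (hu : u ∈ W) :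
    F (jetVec t x, u) = F (jetVec t y, u) := by
  have hs := contDiffOn_space_slice (v := fun s y => F (jetVec s y, u)) (contDiffOn_slice hF hu) ht
  refine hU.is_const_of_fderiv_eq_zero (𝕜 := ℝ) (f := fun y => F (jetVec t y, u)) hUc
    (fun y hy => (differentiableAt_of_contDiffOn hU hs hy).differentiableWithinAt)
    (fun y hy => ?_) hx hy
  ext v
  rw [dirDeriv_pi_eq_sum]
  refine Finset.sum_eq_zero fun α _ => ?_
  rw [← pd_eq_dirDeriv, pd_slice hJ hU hW hF ht hy hu, h0 (jetVec t y, u) ⟨ht, hy, hu⟩,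
    mul_zero]

/-- The evolution operator `Δ - C^α ∂_α - ∂_t`. -/
noncomputable def evolutionOp (g : (Fin n → ℝ) → Matrix (Fin n) (Fin n) ℝ)
    (C : (Fin n → ℝ) → Fin n → ℝ) (v : ℝ → (Fin n → ℝ) → ℝ) (t : ℝ) (x : Fin n → ℝ) : ℝ :=
  laplacian g (v t) x - ∑ α, C x α * pd α (v t) x - deriv (fun s => v s x) t

lemma evolutionOp_eq (hU : IsOpen U) (hg : IsMetricOn U g) {v : ℝ → (Fin n → ℝ) → ℝ}
    (hv : ContDiffOn ℝ ∞ (fun q : ℝ × (Fin n → ℝ) => v q.1 q.2) (J ×ˢ U)) {t : ℝ}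
    {x : Fin n → ℝ} (ht : t ∈ J) (hx : x ∈ U) :
    evolutionOp g C v t x = ∑ α, ∑ β, (g x)⁻¹ α β * pd α (pd β (v t)) x
      + ∑ β, driftCoeff g C β x * pd β (v t) x - deriv (fun s => v s x) t := by
  unfold evolutionOp
  rw [laplacian_eq hU hg (contDiffOn_space_slice hv ht) hx]
  simp only [driftCoeff, sub_mul, Finset.sum_sub_distrib]
  ring

/-- Hence for a symmetry each slice of `η` at fixed `u` is a solution of (E). -/
lemma zeroOrderCond_eq (hJ : IsOpen J) (hU : IsOpen U) (hW : IsOpen W) (hg : IsMetricOn U g)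
    (hX : X.SmoothOn (domain J U W)) {t u : ℝ} {x : Fin n → ℝ} (ht : t ∈ J) (hx : x ∈ U)
    (hu : u ∈ W) :
    zeroOrderCond g C X (jetVec t x, u)
      = evolutionOp g C (fun s y => X.η (jetVec s y, u)) t x := by
  have hΩ := isOpen_domain hJ hU hW
  have h1 : ∀ y ∈ U, ∀ β, pd β (fun y => X.η (jetVec t y, u)) y
      = jx (some β) X.η (jetVec t y, u) := fun y hy β => pd_slice hJ hU hW hX.2 ht hy hu β
  have h2 : ∀ α β, pd α (pd β (fun y => X.η (jetVec t y, u))) x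
      = jx (some β) (jx (some α) X.η) (jetVec t x, u) := fun α β => by
    rw [pd_eq_dirDeriv, dirDeriv_congr hU (fun y hy => h1 y hy β) _ hx, ← pd_eq_dirDeriv,
      pd_slice hJ hU hW (contDiffOn_jx hΩ hX.2 _) ht hx hu]
    exact dirDeriv_comm hΩ hX.2 _ _ ⟨ht, hx, hu⟩
  rw [evolutionOp_eq hU hg (contDiffOn_slice hX.2 hu) ht hx,
    (hasDerivAt_time_slice hJ hU hW hX.2 ht hx hu).deriv]
  simp only [h1 x hx, h2]
  rfl

lemma evolutionOp_lincomb (hJ : IsOpen J) (hU : IsOpen U) (hg : IsMetricOn U g)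
    {v w : ℝ → (Fin n → ℝ) → ℝ}
    (hv : ContDiffOn ℝ ∞ (fun q : ℝ × (Fin n → ℝ) => v q.1 q.2) (J ×ˢ U))
    (hw : ContDiffOn ℝ ∞ (fun q : ℝ × (Fin n → ℝ) => w q.1 q.2) (J ×ˢ U)) (c d : ℝ) {t : ℝ}
    {x : Fin n → ℝ} (ht : t ∈ J) (hx : x ∈ U) :
    evolutionOp g C (fun s y => c * v s y + d * w s y) t x
      = c * evolutionOp g C v t x + d * evolutionOp g C w t x := by
  have hvs := contDiffOn_space_slice hv ht
  have hws := contDiffOn_space_slice hw ht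
  have lin : ∀ {f h : (Fin n → ℝ) → ℝ}, ContDiffOn ℝ ∞ f U → ContDiffOn ℝ ∞ h U → ∀ α, ∀ y ∈ U,
      pd α (fun y => c * f y + d * h y) y = c * pd α f y + d * pd α h y := by
    intro f h hf hh α y hy
    have df := differentiableAt_of_contDiffOn hU hf hy
    have dh := differentiableAt_of_contDiffOn hU hh hy
    rw [pd_eq_dirDeriv, dirDeriv_add (df.const_mul c) (dh.const_mul d), dirDeriv_const_mul df,
      dirDeriv_const_mul dh]
    rfl
  have h2 : ∀ α β, pd α (pd β (fun y => c * v t y + d * w t y)) x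
      = c * pd α (pd β (v t)) x + d * pd α (pd β (w t)) x := fun α β => by
    rw [pd_eq_dirDeriv, dirDeriv_congr hU (fun y hy => lin hvs hws β y hy) _ hx,
      ← pd_eq_dirDeriv, lin (contDiffOn_pd hU hvs β) (contDiffOn_pd hU hws β) α x hx]
  have dv := differentiableAt_of_contDiffOn hJ (contDiffOn_time_slice hv hx) ht
  have dw := differentiableAt_of_contDiffOn hJ (contDiffOn_time_slice hw hx) ht
  have h3 : deriv (fun s => c * v s x + d * w s x) t
      = c * deriv (fun s => v s x) t + d * deriv (fun s => w s x) t :=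
    ((dv.hasDerivAt.const_mul c).fun_add (dw.hasDerivAt.const_mul d)).deriv
  have hvw : ContDiffOn ℝ ∞ (fun q : ℝ × (Fin n → ℝ) => c * v q.1 q.2 + d * w q.1 q.2) (J ×ˢ U) :=
    (contDiffOn_const.mul hv).add (contDiffOn_const.mul hw)
  rw [evolutionOp_eq hU hg hvw ht hx, evolutionOp_eq hU hg hv ht hx,
    evolutionOp_eq hU hg hw ht hx, h3]
  simp only [h2, lin hvs hws _ x hx, mul_add, Finset.sum_add_distrib, mul_sub, Finset.mul_sum]
  simp only [mul_left_comm c, mul_left_comm d]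
  ring

lemma IsSolutionOn.lincomb (hJ : IsOpen J) (hU : IsOpen U) (hg : IsMetricOn U g)
    {v w : ℝ → (Fin n → ℝ) → ℝ} (hv : IsSolutionOn J U g C v) (hw : IsSolutionOn J U g C w)
    (c d : ℝ) : IsSolutionOn J U g C (fun s y => c * v s y + d * w s y) where
  smooth := (contDiffOn_const.mul hv.smooth).add (contDiffOn_const.mul hw.smooth)
  eq_zero t ht x hx := by
    have h := evolutionOp_lincomb (C := C) hJ hU hg hv.smooth hw.smooth c d ht hx
    have h1 : evolutionOp g C v t x = 0 := hv.eq_zero t ht x hx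
    have h2 : evolutionOp g C w t x = 0 := hw.eq_zero t ht x hx
    rw [h1, h2] at h
    exact h.trans (by ring)

lemma isSolutionOn_const (c : ℝ) : IsSolutionOn J U g C (fun _ _ => c) where
  smooth := contDiffOn_const
  eq_zero t ht x hx := by simp [laplacian, pd]

lemma IsSolutionOn.congr (hJ : IsOpen J) (hU : IsOpen U) (hg : IsMetricOn U g)
    {v w : ℝ → (Fin n → ℝ) → ℝ} (hv : IsSolutionOn J U g C v)
    (h : ∀ t ∈ J, ∀ x ∈ U, w t x = v t x) : IsSolutionOn J U g C w := by
  have hs : ContDiffOn ℝ ∞ (fun q : ℝ × (Fin n → ℝ) => w q.1 q.2) (J ×ˢ U) :=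
    hv.smooth.congr fun q hq => h _ hq.1 _ hq.2
  refine ⟨hs, fun t ht x hx => ?_⟩
  have h1 : evolutionOp g C v t x = 0 := hv.eq_zero t ht x hx
  have p1 : ∀ y ∈ U, ∀ β, pd β (w t) y = pd β (v t) y := fun y hy β =>
    dirDeriv_congr hU (fun y hy => h t ht y hy) _ hy
  have p2 : ∀ α β, pd α (pd β (w t)) x = pd α (pd β (v t)) x := fun α β =>
    dirDeriv_congr hU (fun y hy => p1 y hy β) _ hx
  have p3 : deriv (fun s => w s x) t = deriv (fun s => v s x) t :=
    (Filter.eventuallyEq_of_mem (hJ.mem_nhds ht) fun s hs => h s hs x hx).deriv_eq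
  change evolutionOp g C w t x = 0
  rw [← h1, evolutionOp_eq hU hg hs ht hx, evolutionOp_eq hU hg hv.smooth ht hx, p3]
  simp only [p1 x hx, p2]

/-- The coefficients of the second derivatives of `u` say that `ξ^α` is homothetic. -/
lemma symbolCond_eq_zero_iff (hJ : IsOpen J) (hU : IsOpen U) (hW : IsOpen W)
    (hg : IsMetricOn U g) (hX : X.SmoothOn (domain J U W)) {t u : ℝ} {x : Fin n → ℝ} (ht : t ∈ J)
    (hx : x ∈ U) (hu : u ∈ W) :
    (∀ α β, symbolCond g X α β 0 (jetVec t x, u) = 0) ↔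
      ∀ α β, lieMetric (fun y γ => X.ξ (some γ) (jetVec t y, u)) g x α β
        = jx none (X.ξ none) (jetVec t x, u) * g x α β := by
  rw [lieMetric_eq_iff hU hg hx]
  refine forall_congr' fun α => forall_congr' fun β => ?_
  simp only [pd_slice hJ hU hW (hX.1 _) ht hx hu]
  have hs : space (jetVec t x) = x := rfl
  have ht : ∀ γ F, tot (some γ) 0 F (jetVec t x, u) = jx (some γ) F (jetVec t x, u) :=
    fun γ F => by simp [tot]
  simp only [symbolCond, symbolDeriv, hs, ht, hg.inv_symm hx _ α]
  constructor <;> intro h <;> linarith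

/-- The Leibniz rule `L_Y(g C) = (L_Y g) C + g [Y, C]`, with `L_Y g = c g` inserted. -/
lemma lieCovector_lower (hU : IsOpen U) (hg : IsMetricOn U g) (hC : ContDiffOn ℝ ∞ C U)
    {Y : (Fin n → ℝ) → Fin n → ℝ} {x : Fin n → ℝ} {c : ℝ} (hx : x ∈ U)
    (hY : ∀ α β, lieMetric Y g x α β = c * g x α β) (α : Fin n) :
    lieCovector Y (lower g C) x α = ∑ δ, g x α δ * (∑ γ, Y x γ * pd γ (fun y => C y δ) x
      - ∑ γ, C x γ * pd γ (fun y => Y y δ) x + c * C x δ) := by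
  have D : ∀ {f : (Fin n → ℝ) → ℝ}, ContDiffOn ℝ ∞ f U → DifferentiableAt ℝ f x :=
    fun h => differentiableAt_of_contDiffOn hU h hx
  have hCs := contDiffOn_component hC
  have hl : ∀ γ, pd γ (fun y => lower g C y α) x
      = ∑ β, (pd γ (fun y => g y α β) x * C x β + g x α β * pd γ (fun y => C y β) x) := by
    intro γ
    unfold lower
    rw [pd_eq_dirDeriv, dirDeriv_sum fun β _ => (D (hg.smooth α β)).fun_mul (D (hCs β))]
    exact Finset.sum_congr rfl fun β _ => dirDeriv_mul (D (hg.smooth α β)) (D (hCs β)) _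
  have hc : ∑ δ, g x α δ * (c * C x δ) = ∑ δ, C x δ * lieMetric Y g x α δ :=
    Finset.sum_congr rfl fun δ _ => by rw [hY]; ring
  simp only [mul_add, mul_sub, Finset.sum_add_distrib, Finset.sum_sub_distrib, hc]
  simp only [lieCovector, hl]
  simp only [lieMetric, lower, mul_add, Finset.sum_add_distrib, Finset.mul_sum,
    Finset.sum_mul]
  have e1 : ∑ γ, ∑ β, Y x γ * (pd γ (fun y => g y α β) x * C x β)
      = ∑ δ, ∑ γ, C x δ * (Y x γ * pd γ (fun y => g y α δ) x) := by
    rw [Finset.sum_comm]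
    exact Finset.sum_congr rfl fun _ _ => Finset.sum_congr rfl fun _ _ => by ring
  have e2 : ∑ γ, ∑ β, Y x γ * (g x α β * pd γ (fun y => C y β) x)
      = ∑ δ, ∑ γ, g x α δ * (Y x γ * pd γ (fun y => C y δ) x) := by
    rw [Finset.sum_comm]
    exact Finset.sum_congr rfl fun _ _ => Finset.sum_congr rfl fun _ _ => by ring
  have e3 : ∑ γ, ∑ β, g x γ β * C x β * pd α (fun y => Y y γ) x
      = ∑ δ, ∑ γ, C x δ * (g x γ δ * pd α (fun y => Y y γ) x) := by
    rw [Finset.sum_comm]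
    exact Finset.sum_congr rfl fun _ _ => Finset.sum_congr rfl fun _ _ => by ring
  have e4 : ∑ δ, ∑ γ, C x δ * (g x α γ * pd δ (fun y => Y y γ) x)
      = ∑ δ, ∑ γ, g x α δ * (C x γ * pd γ (fun y => Y y δ) x) := by
    rw [Finset.sum_comm]
    exact Finset.sum_congr rfl fun _ _ => Finset.sum_congr rfl fun _ _ => by ring
  rw [e1, e2, e3, e4]
  ring

/-- The condition on the coefficients of `u_{,δ}`, with lowered index. -/
lemma firstOrderCond_eq_zero_iff (hJ : IsOpen J) (hU : IsOpen U) (hW : IsOpen W)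
    (hg : IsMetricOn U g) (hC : ContDiffOn ℝ ∞ C U) (hX : X.SmoothOn (domain J U W)) {t u ψ : ℝ}
    {x : Fin n → ℝ} (ht : t ∈ J) (hx : x ∈ U) (hu : u ∈ W)
    (hY : IsHomotheticOn U g (fun y γ => X.ξ (some γ) (jetVec t y, u)) ψ)
    (hτ : jx none (X.ξ none) (jetVec t x, u) = 2 * ψ) :
    (∀ δ, firstOrderCond g C X δ (jetVec t x, u) = 0) ↔
      ∀ α, lieCovector (fun y γ => X.ξ (some γ) (jetVec t y, u)) (lower g C) x α
        - ∑ δ, g x α δ * jx none (X.ξ (some δ)) (jetVec t x, u)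
        - 2 * jx (some α) (ju X.η) (jetVec t x, u) = 0 := by
  have hΩ := isOpen_domain hJ hU hW
  have hs : space (jetVec t x) = x := rfl
  have D : ∀ {f : (Fin n → ℝ) → ℝ}, ContDiffOn ℝ ∞ f U → DifferentiableAt ℝ f x :=
    fun h => differentiableAt_of_contDiffOn hU h hx
  have hp : ∀ y ∈ U, ∀ β δ, pd β (fun y => X.ξ (some δ) (jetVec t y, u)) y
      = jx (some β) (X.ξ (some δ)) (jetVec t y, u) := fun y hy β δ =>
    pd_slice hJ hU hW (hX.1 _) ht hy hu β
  have hpp : ∀ α β δ, pd α (pd β (fun y => X.ξ (some δ) (jetVec t y, u))) x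
      = jx (some β) (jx (some α) (X.ξ (some δ))) (jetVec t x, u) := fun α β δ => by
    rw [pd_eq_dirDeriv, dirDeriv_congr hU (fun y hy => hp y hy β δ) _ hx, ← pd_eq_dirDeriv,
      pd_slice hJ hU hW (contDiffOn_jx hΩ (hX.1 _) _) ht hx hu]
    exact dirDeriv_comm hΩ (hX.1 _) _ _ ⟨ht, hx, hu⟩
  have hB : ∀ γ δ, pd γ (driftCoeff g C δ) x
      = pd γ (fun y => laplacianDrift g y δ) x - pd γ (fun y => C y δ) x := fun γ δ =>
    dirDeriv_sub (D (contDiffOn_laplacianDrift hU hg δ)) (D (contDiffOn_component hC δ)) _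
  -- The drift identity for homothetic fields removes every Laplacian term; its `-2ψ` multiple of
  -- the drift is cancelled by `ξ^t_{,t} = 2ψ`.
  have hfirst : ∀ δ, firstOrderCond g C X δ (jetVec t x, u)
      = 2 * ∑ α, (g x)⁻¹ δ α * jx (some α) (ju X.η) (jetVec t x, u)
        - (∑ γ, X.ξ (some γ) (jetVec t x, u) * pd γ (fun y => C y δ) x
        - ∑ γ, C x γ * pd γ (fun y => X.ξ (some δ) (jetVec t y, u)) x + 2 * ψ * C x δ)
        + jx none (X.ξ (some δ)) (jetVec t x, u) := by
    intro δ
    have h := hY.apply_laplacianDrift hU hg hx δ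
    simp only [hp x hx, hpp] at h ⊢
    simp only [firstOrderCond, driftDeriv, hs, hB, hτ, mul_sub, Finset.sum_sub_distrib, h,
      hg.inv_symm hx δ]
    simp only [driftCoeff, sub_mul, Finset.sum_sub_distrib]
    ring
  -- Contraction with the invertible `g` loses nothing, hence an equivalence.
  have hlow : ∀ α, ∑ δ, g x α δ * firstOrderCond g C X δ (jetVec t x, u)
      = -(lieCovector (fun y γ => X.ξ (some γ) (jetVec t y, u)) (lower g C) x α
        - ∑ δ, g x α δ * jx none (X.ξ (some δ)) (jetVec t x, u)
        - 2 * jx (some α) (ju X.η) (jetVec t x, u)) := by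
    intro α
    have e : ∑ δ, g x α δ * (2 * ∑ β, (g x)⁻¹ δ β * jx (some β) (ju X.η) (jetVec t x, u))
        = 2 * jx (some α) (ju X.η) (jetVec t x, u) := by
      have h := congrArg (fun N : Matrix (Fin n) (Fin n) ℝ =>
        N.mulVec (fun β => jx (some β) (ju X.η) (jetVec t x, u)) α) (hg.mul_inv_cancel hx)
      simp only [← Matrix.mulVec_mulVec, Matrix.one_mulVec] at h
      rw [← h]
      simp only [Matrix.mulVec, dotProduct, Finset.mul_sum]
      exact Finset.sum_congr rfl fun _ _ => Finset.sum_congr rfl fun _ _ => by ring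
    rw [lieCovector_lower hU hg hC hx (hY.lie_eq x hx) α]
    simp only [hfirst]
    rw [← e]
    simp only [mul_add (g x α _), mul_sub (g x α _), Finset.sum_add_distrib,
      Finset.sum_sub_distrib]
    ring
  constructor
  · intro h α
    have h1 := hlow α
    simp only [h, mul_zero, Finset.sum_const_zero] at h1
    linarith
  · intro h δ
    have h0 : (g x).mulVec (fun δ => firstOrderCond g C X δ (jetVec t x, u)) = 0 :=
      funext fun α => (hlow α).trans (by rw [h α, neg_zero]; rfl)
    have h1 := congrArg (g x)⁻¹.mulVec h0
    rw [Matrix.mulVec_mulVec, hg.inv_mul_cancel hx, Matrix.one_mulVec, Matrix.mulVec_zero] at h1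
    exact congrFun h1 δ

end Slices

/-! ### Coefficient functions, integration, and both directions of the equivalence. -/

/-- Coordinate functionals of a linearly independent family of functions can be chosen as
combinations of evaluations. -/
lemma exists_dual_evaluations {κ m : Type*} {d : ℕ} {Y : Fin d → κ → m → ℝ}
    (hY : LinearIndependent ℝ Y) :
    ∃ l : Fin d → (κ × m →₀ ℝ), ∀ I K,
      (l I).sum (fun k a => a * Y K k.1 k.2) = if K = I then 1 else 0 := by
  let e : κ × m → Fin d → ℝ := fun k K => Y K k.1 k.2
  have hspan : Submodule.span ℝ (Set.range e) = ⊤ := by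
    -- A nonzero functional that kills every vector `(Y_K^α(x))_K` would be a linear relation among
    -- the `Y_K`. So these vectors span, and each unit vector is a finite combination of them.
    by_contra hne
    obtain ⟨f, hf0, hf⟩ := Submodule.exists_le_ker_of_lt_top _ (lt_top_iff_ne_top.2 hne)
    have hsum : ∑ I, f (Pi.single I 1) • Y I = 0 := by
      funext x α
      have h1 : f (e (x, α)) = 0 := hf (Submodule.subset_span ⟨(x, α), rfl⟩)
      rw [pi_eq_sum_univ' (e (x, α)), map_sum] at h1
      simp only [map_smul, smul_eq_mul] at h1
      simpa [e, Finset.sum_apply, mul_comm] using h1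
    have h0 := Fintype.linearIndependent_iff.1 hY _ hsum
    refine hf0 (LinearMap.ext fun v => ?_)
    rw [pi_eq_sum_univ' v, map_sum]
    simp [h0]
  have hmem : ∀ I : Fin d, ∃ c : κ × m →₀ ℝ, (c.sum fun i a => a • e i) = Pi.single I 1 := fun I =>
    Finsupp.mem_span_range_iff_exists_finsupp.1 (hspan ▸ Submodule.mem_top)
  choose l hl using hmem
  refine ⟨l, fun I K => ?_⟩
  have h := congrFun (hl I) K
  rw [Pi.single_apply] at h
  rw [← h, Finsupp.sum, Finsupp.sum, Finset.sum_apply]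
  rfl

lemma hasDerivAt_integral_of_continuousOn {J : Set ℝ} (hJ : IsOpen J) (hJc : J.OrdConnected)
    {t₀ t : ℝ} (ht₀ : t₀ ∈ J) (ht : t ∈ J) {f : ℝ → ℝ} (hf : ContinuousOn f J) :
    HasDerivAt (fun s => ∫ r in t₀..s, f r) (f t) t :=
  intervalIntegral.integral_hasDerivAt_right
    (hf.mono (hJc.uIcc_subset ht₀ ht)).intervalIntegrable
    (hf.stronglyMeasurableAtFilter hJ t ht) (hf.continuousAt (hJ.mem_nhds ht))

section Main

variable {n d : ℕ} {J : Set ℝ} {U : Set (Fin n → ℝ)} {W : Set ℝ} {t₀ : ℝ}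
  {g : (Fin n → ℝ) → Matrix (Fin n) (Fin n) ℝ} {C : (Fin n → ℝ) → Fin n → ℝ}
  {Y : Fin d → (Fin n → ℝ) → Fin n → ℝ} {ψ : Fin d → ℝ}
  {X : PointField (Option (Fin n))} {T : Fin d → ℝ → ℝ}

/-- The explicit form of the symmetries of the evolution equation. -/
structure IsSymmetryForm (J : Set ℝ) (U : Set (Fin n → ℝ)) (W : Set ℝ) (t₀ : ℝ)
    (g : (Fin n → ℝ) → Matrix (Fin n) (Fin n) ℝ) (C : (Fin n → ℝ) → Fin n → ℝ)
    (Y : Fin d → (Fin n → ℝ) → Fin n → ℝ) (ψ : Fin d → ℝ) (X : PointField (Option (Fin n)))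
    (c₁ c₂ : ℝ) (T : Fin d → ℝ → ℝ) (a b : ℝ → (Fin n → ℝ) → ℝ) : Prop where
  smooth : ∀ I, ContDiffOn ℝ ∞ (T I) J
  solution_a : IsSolutionOn J U g C a
  solution_b : IsSolutionOn J U g C b
  lie_eq : ∀ t ∈ J, ∀ x ∈ U, ∀ α,
    ∑ I, (T I t * lieCovector (Y I) (lower g C) x α - deriv (T I) t * lower g (Y I) x α)
      - 2 * pd α (a t) x = 0
  time_eq : ∀ z u, (z, u) ∈ domain J U W →
    X.ξ none (z, u) = c₁ + 2 * ∑ I, ψ I * ∫ t in t₀..(z none), T I t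
  space_eq : ∀ z u, (z, u) ∈ domain J U W → ∀ α,
    X.ξ (some α) (z, u) = ∑ I, T I (z none) * Y I (space z) α
  eta_eq : ∀ z u, (z, u) ∈ domain J U W →
    X.η (z, u) = (a (z none) (space z) + c₂) * u + b (z none) (space z)

lemma isHomotheticOn_space_slice (hU : IsOpen U) (hY : ∀ I, IsHomotheticOn U g (Y I) (ψ I))
    (hspace : ∀ z u, (z, u) ∈ domain J U W → ∀ α,
      X.ξ (some α) (z, u) = ∑ I, T I (z none) * Y I (space z) α)
    {t u : ℝ} (ht : t ∈ J) (hu : u ∈ W) :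
    IsHomotheticOn U g (fun y γ => X.ξ (some γ) (jetVec t y, u)) (∑ I, T I t * ψ I) := by
  refine (IsHomotheticOn.sum_smul hU Finset.univ hY fun I => T I t).congr hU fun x hx => ?_
  funext γ
  rw [hspace _ _ (jetVec_mem_domain ht hx hu), Finset.sum_apply]
  rfl

lemma jx_none_space (hJ : IsOpen J) (hU : IsOpen U) (hW : IsOpen W)
    (hX : X.SmoothOn (domain J U W)) (hT : ∀ I, ContDiffOn ℝ ∞ (T I) J)
    (hspace : ∀ z u, (z, u) ∈ domain J U W → ∀ α,
      X.ξ (some α) (z, u) = ∑ I, T I (z none) * Y I (space z) α)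
    {t u : ℝ} {x : Fin n → ℝ} (ht : t ∈ J) (hx : x ∈ U) (hu : u ∈ W) (δ : Fin n) :
    jx none (X.ξ (some δ)) (jetVec t x, u) = ∑ I, deriv (T I) t * Y I x δ := by
  refine (hasDerivAt_time_slice hJ hU hW (hX.1 _) ht hx hu).unique ?_
  refine HasDerivAt.congr_of_eventuallyEq (f := fun s => ∑ I, T I s * Y I x δ)
    (HasDerivAt.fun_sum fun I _ =>
      (differentiableAt_of_contDiffOn hJ (hT I) ht).hasDerivAt.mul_const _) ?_
  exact Filter.eventuallyEq_of_mem (hJ.mem_nhds ht) fun s hs => hspace _ _ (jetVec_mem_domain hs hx hu) δ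

lemma lieCovector_sum (hU : IsOpen U) {Z : (Fin n → ℝ) → Fin n → ℝ}
    (hY : ∀ I, ContDiffOn ℝ ∞ (Y I) U) (c : Fin d → ℝ)
    (hZ : ∀ y ∈ U, ∀ γ, Z y γ = ∑ I, c I * Y I y γ) (w : (Fin n → ℝ) → Fin n → ℝ)
    {x : Fin n → ℝ} (hx : x ∈ U) (α : Fin n) :
    lieCovector Z w x α = ∑ I, c I * lieCovector (Y I) w x α := by
  have hd := fun I γ => differentiableAt_of_contDiffOn hU (contDiffOn_component (hY I) γ) hx
  have hp : ∀ γ, pd α (fun y => Z y γ) x = ∑ I, c I * pd α (fun y => Y I y γ) x := by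
    intro γ
    rw [pd_eq_dirDeriv, dirDeriv_congr hU (fun y hy => hZ y hy γ) _ hx,
      dirDeriv_sum fun I _ => (hd I γ).const_mul (c I)]
    exact Finset.sum_congr rfl fun I _ => dirDeriv_const_mul (hd I γ) _ _
  simp only [lieCovector, hp, hZ x hx, Finset.sum_mul, Finset.mul_sum, ← Finset.sum_add_distrib]
  rw [Finset.sum_comm]
  exact Finset.sum_congr rfl fun _ _ => Finset.sum_congr rfl fun _ _ => by ring

lemma sum_lieCovector_sub (hJ : IsOpen J) (hU : IsOpen U) (hW : IsOpen W)
    (hX : X.SmoothOn (domain J U W)) (hT : ∀ I, ContDiffOn ℝ ∞ (T I) J)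
    (hY : ∀ I, ContDiffOn ℝ ∞ (Y I) U)
    (hspace : ∀ z u, (z, u) ∈ domain J U W → ∀ α,
      X.ξ (some α) (z, u) = ∑ I, T I (z none) * Y I (space z) α)
    {t u : ℝ} {x : Fin n → ℝ} (ht : t ∈ J) (hx : x ∈ U) (hu : u ∈ W) (α : Fin n) :
    ∑ I, (T I t * lieCovector (Y I) (lower g C) x α - deriv (T I) t * lower g (Y I) x α)
      = lieCovector (fun y γ => X.ξ (some γ) (jetVec t y, u)) (lower g C) x α
        - ∑ δ, g x α δ * jx none (X.ξ (some δ)) (jetVec t x, u) := by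
  rw [lieCovector_sum hU hY (fun I => T I t) (fun y hy γ => hspace _ _ (jetVec_mem_domain ht hy hu) γ) _ hx,
    Finset.sum_sub_distrib]
  simp only [jx_none_space hJ hU hW hX hT hspace ht hx hu, lower, Finset.mul_sum]
  congr 1
  rw [Finset.sum_comm]
  exact Finset.sum_congr rfl fun _ _ => Finset.sum_congr rfl fun _ _ => by ring

lemma IsSymmetryForm.isLiePointSymmetry (hU : IsOpen U) (hJ : IsOpen J) (hJc : J.OrdConnected)
    (hW : IsOpen W) (ht₀ : t₀ ∈ J) (hg : IsMetricOn U g) (hC : ContDiffOn ℝ ∞ C U)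
    (hY : ∀ I, IsHomotheticOn U g (Y I) (ψ I)) (hX : X.SmoothOn (domain J U W)) {c₁ c₂ : ℝ}
    {a b : ℝ → (Fin n → ℝ) → ℝ} (h : IsSymmetryForm J U W t₀ g C Y ψ X c₁ c₂ T a b) :
    IsLiePointSymmetry (evolutionTheta g C) (domain J U W) X := by
  have hΩ := isOpen_domain hJ hU hW
  refine isLiePointSymmetry_of_determining hJ hU hW hg hC hX ?_
  rintro ⟨z, u⟩ ⟨ht, hx, hu⟩
  obtain ⟨t, x, rfl⟩ : ∃ t x, z = jetVec t x := ⟨_, _, (jetVec_space z).symm⟩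
  change t ∈ J at ht
  change x ∈ U at hx
  change u ∈ W at hu
  have hτ : jx none (X.ξ none) (jetVec t x, u) = 2 * ∑ I, T I t * ψ I := by
    refine (hasDerivAt_time_slice hJ hU hW (hX.1 _) ht hx hu).unique ?_
    refine HasDerivAt.congr_of_eventuallyEq
      (f := fun s => c₁ + 2 * ∑ I, ψ I * ∫ r in t₀..s, T I r) ?_
      (Filter.eventuallyEq_of_mem (hJ.mem_nhds ht) fun s hs => h.time_eq _ _ (jetVec_mem_domain hs hx hu))
    have hd := ((HasDerivAt.fun_sum (u := Finset.univ) fun I _ =>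
      (hasDerivAt_integral_of_continuousOn hJ hJc ht₀ ht (h.smooth I).continuousOn).const_mul
        (ψ I)).const_mul 2).const_add c₁
    simpa only [mul_comm (ψ _)] using hd
  have hhom := isHomotheticOn_space_slice hU hY h.space_eq ht hu
  have hju : ∀ z u, (z, u) ∈ domain J U W → ju X.η (z, u) = a (z none) (space z) + c₂ := by
    intro z u hw
    refine (hasDerivAt_u_slice hΩ hX.2 hw).unique ?_
    refine HasDerivAt.congr_of_eventuallyEq
      (f := fun v => (a (z none) (space z) + c₂) * v + b (z none) (space z)) ?_
      (Filter.eventuallyEq_of_mem (hW.mem_nhds hw.2.2) fun v hv =>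
        h.eta_eq _ _ ⟨hw.1, hw.2.1, hv⟩)
    simpa using ((hasDerivAt_id u).const_mul (a (z none) (space z) + c₂)).add_const
      (b (z none) (space z))
  have hju_zero : ∀ {F : Jet0 (Option (Fin n)) → ℝ} {G : (Option (Fin n) → ℝ) → ℝ},
      ContDiffOn ℝ ∞ F (domain J U W) → (∀ z u, (z, u) ∈ domain J U W → F (z, u) = G z) →
      ju F (jetVec t x, u) = 0 := by
    intro F G hF hFG
    refine (hasDerivAt_u_slice hΩ hF (jetVec_mem_domain ht hx hu)).unique ?_
    exact HasDerivAt.congr_of_eventuallyEq (hasDerivAt_const u (G (jetVec t x)))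
      (Filter.eventuallyEq_of_mem (hW.mem_nhds hu) fun v hv => hFG _ _ (jetVec_mem_domain ht hx hv))
  refine ⟨fun α => ?_, hju_zero (hX.1 _) h.time_eq,
    fun γ => hju_zero (hX.1 _) fun z u hw => h.space_eq z u hw γ,
    hju_zero (contDiffOn_ju hΩ hX.2) hju, ?_, ?_, ?_⟩
  · have hconst : Set.EqOn (fun y => X.ξ none (jetVec t y, u))
        (fun _ => c₁ + 2 * ∑ I, ψ I * ∫ r in t₀..t, T I r) U := fun y hy =>
      h.time_eq _ _ (jetVec_mem_domain ht hy hu)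
    rw [← pd_slice hJ hU hW (hX.1 _) ht hx hu, pd_eq_dirDeriv, dirDeriv_congr hU hconst _ hx,
      dirDeriv_const]
  · refine (symbolCond_eq_zero_iff hJ hU hW hg hX ht hx hu).2 fun α β => ?_
    rw [hτ]
    exact hhom.lie_eq x hx α β
  · refine (firstOrderCond_eq_zero_iff hJ hU hW hg hC hX ht hx hu hhom hτ).2 fun α => ?_
    have ha : jx (some α) (ju X.η) (jetVec t x, u) = pd α (a t) x := by
      have hd := differentiableAt_of_contDiffOn hU
        (contDiffOn_space_slice h.solution_a.smooth ht) hx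
      rw [← pd_slice hJ hU hW (contDiffOn_ju hΩ hX.2) ht hx hu, pd_eq_dirDeriv,
        dirDeriv_congr hU (fun y hy => hju _ _ (jetVec_mem_domain ht hy hu)) _ hx]
      refine (dirDeriv_add hd (differentiableAt_const c₂) _).trans ?_
      rw [dirDeriv_const, add_zero]
      rfl
    rw [ha, ← sum_lieCovector_sub hJ hU hW hX h.smooth (fun I => (hY I).smooth) h.space_eq ht hx hu]
    exact h.lie_eq t ht x hx α
  · rw [zeroOrderCond_eq hJ hU hW hg hX ht hx hu]
    -- At fixed `u`, `η = u (a + c₂) + b` is a combination of solutions, because constants solve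
    -- (E).
    have hs := ((h.solution_a.lincomb hJ hU hg (isSolutionOn_const c₂) u u).lincomb hJ hU hg
      h.solution_b 1 1).congr hJ hU hg (w := fun s y => X.η (jetVec s y, u)) fun s hs y hy => by
        rw [h.eta_eq _ _ (jetVec_mem_domain hs hy hu)]
        change (a s y + c₂) * u + b s y = _
        ring
    exact hs.eq_zero t ht x hx

lemma IsLiePointSymmetry.exists_isSymmetryForm (hn : 0 < n) (hU : IsOpen U) (hUc : IsConnected U)
    (hJ : IsOpen J) (hJc : J.OrdConnected) (hW : IsOpen W) (hWc : W.OrdConnected)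
    (hWne : W.Nonempty) (ht₀ : t₀ ∈ J) (hg : IsMetricOn U g) (hC : ContDiffOn ℝ ∞ C U)
    (hY : IsHomotheticBasis U g Y ψ) (hX : X.SmoothOn (domain J U W))
    (h : IsLiePointSymmetry (evolutionTheta g C) (domain J U W) X) :
    ∃ c₁ c₂ T a b, IsSymmetryForm J U W t₀ g C Y ψ X c₁ c₂ T a b := by
  have hΩ := isOpen_domain hJ hU hW
  have det := fun w (hw : w ∈ domain J U W) => h.determining hn hJ hU hW hg hC hX hw
  obtain ⟨x₀, hx₀⟩ := hUc.nonempty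
  obtain ⟨u₀, hu₀⟩ := hWne
  have hτ : ∀ {t x u}, t ∈ J → x ∈ U → u ∈ W →
      X.ξ none (jetVec t x, u) = X.ξ none (jetVec t x₀, u₀) := fun {t x u} ht hx hu =>
    (eq_of_ju_eq_zero hJ hU hW hWc (hX.1 _) (fun w hw => (det w hw).time_u) (jetVec_mem_domain ht hx hu)
      (jetVec_mem_domain ht hx hu₀)).trans (eq_of_jx_some_eq_zero hJ hU hUc.isPreconnected hW (hX.1 _)
      (fun w hw => (det w hw).time_x) ht hx hx₀ hu₀)
  have hτ' : ∀ {t x u}, t ∈ J → x ∈ U → u ∈ W →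
      jx none (X.ξ none) (jetVec t x, u) = jx none (X.ξ none) (jetVec t x₀, u₀) := by
    intro t x u ht hx hu
    refine (hasDerivAt_time_slice hJ hU hW (hX.1 _) ht hx hu).unique ?_
    exact (hasDerivAt_time_slice hJ hU hW (hX.1 _) ht hx₀ hu₀).congr_of_eventuallyEq
      (Filter.eventuallyEq_of_mem (hJ.mem_nhds ht) fun s hs => hτ hs hx hu)
  have hξ : ∀ {z u}, (z, u) ∈ domain J U W → ∀ γ, X.ξ (some γ) (z, u) = X.ξ (some γ) (z, u₀) :=
    fun {z u} hw γ => eq_of_ju_eq_zero hJ hU hW hWc (hX.1 _) (fun w hw => (det w hw).space_u γ) hw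
      ⟨hw.1, hw.2.1, hu₀⟩
  have hhom : ∀ t ∈ J, IsHomotheticOn U g (fun y γ => X.ξ (some γ) (jetVec t y, u₀))
      (1 / 2 * jx none (X.ξ none) (jetVec t x₀, u₀)) := by
    intro t ht
    refine ⟨contDiffOn_pi.2 fun γ => contDiffOn_space_slice
      (v := fun s y => X.ξ (some γ) (jetVec s y, u₀)) (contDiffOn_slice (hX.1 _) hu₀) ht,
      fun x hx α β => ?_⟩
    rw [(symbolCond_eq_zero_iff hJ hU hW hg hX ht hx hu₀).1
      (det (jetVec t x, u₀) (jetVec_mem_domain ht hx hu₀)).symbol α β, hτ' ht hx hu₀]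
    ring
  choose c hc using fun t : J => hY.spanning _ _ (hhom t t.2)
  obtain ⟨l, hl⟩ := exists_dual_evaluations hY.linearIndependent
  -- The coefficients `c` are chosen separately at each `t`, with no control of their regularity.
  -- Applying the dual evaluations to `ξ` recovers them as finite sums of smooth functions of `t`.
  let T : Fin d → ℝ → ℝ := fun I t =>
    (l I).sum fun k a => a * X.ξ (some k.2) (jetVec t k.1, u₀)
  have hTc : ∀ t (ht : t ∈ J) I, T I t = c ⟨t, ht⟩ I := by
    intro t ht I
    have e : ∀ k : U × Fin n, X.ξ (some k.2) (jetVec t k.1, u₀)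
        = ∑ K, c ⟨t, ht⟩ K * Y K k.1 k.2 := fun k => by
      have := congrFun (hc ⟨t, ht⟩ k.1 k.1.2) k.2
      simpa [Finset.sum_apply] using this
    have e2 : T I t = ∑ K, c ⟨t, ht⟩ K * (l I).sum (fun k a => a * Y K k.1 k.2) := by
      simp only [T, e, Finsupp.sum, Finset.mul_sum]
      rw [Finset.sum_comm]
      exact Finset.sum_congr rfl fun _ _ => Finset.sum_congr rfl fun _ _ => by ring
    have hl' : ∀ K, (l I).sum (fun k a => a * Y K k.1 k.2) = if K = I then 1 else 0 := hl I
    simp [e2, hl']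
  have hT : ∀ I, ContDiffOn ℝ ∞ (T I) J := fun I =>
    ContDiffOn.sum fun k _ => contDiffOn_const.mul (contDiffOn_time_slice
      (v := fun s y => X.ξ (some k.2) (jetVec s y, u₀)) (contDiffOn_slice (hX.1 _) hu₀) k.1.2)
  have hspace : ∀ z u, (z, u) ∈ domain J U W → ∀ α,
      X.ξ (some α) (z, u) = ∑ I, T I (z none) * Y I (space z) α := by
    intro z u hw α
    have h1 := congrFun (hc ⟨z none, hw.1⟩ (space z) hw.2.1) α
    simp only [jetVec_space] at h1
    rw [hξ hw, h1, Finset.sum_apply]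
    exact Finset.sum_congr rfl fun I _ => by rw [hTc _ hw.1]; rfl
  have hfactor : ∀ t ∈ J, jx none (X.ξ none) (jetVec t x₀, u₀) = 2 * ∑ I, T I t * ψ I := by
    intro t ht
    have := (hhom t ht).factor_unique hn hg hUc.nonempty
      (isHomotheticOn_space_slice hU hY.homothetic hspace ht hu₀)
    rw [← this]
    ring
  have hju : ∀ {z u}, (z, u) ∈ domain J U W → ju X.η (z, u) = ju X.η (z, u₀) := fun {z u} hw =>
    eq_of_ju_eq_zero hJ hU hW hWc (contDiffOn_ju hΩ hX.2) (fun w hw => (det w hw).eta_uu) hw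
      ⟨hw.1, hw.2.1, hu₀⟩
  have haff : ∀ {z u}, (z, u) ∈ domain J U W →
      X.η (z, u) = X.η (z, u₀) + ju X.η (z, u₀) * (u - u₀) := by
    intro z u hw
    have hd : ∀ v ∈ W, HasDerivAt (fun v => X.η (z, v) - ju X.η (z, u₀) * v) 0 v := by
      intro v hv
      have h1 := (hasDerivAt_u_slice hΩ hX.2 (u := v) ⟨hw.1, hw.2.1, hv⟩).fun_sub
        ((hasDerivAt_id v).const_mul (ju X.η (z, u₀)))
      have h2 : ju X.η (z, v) = ju X.η (z, u₀) := hju ⟨hw.1, hw.2.1, hv⟩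
      simpa [h2] using h1
    have := hW.is_const_of_deriv_eq_zero hWc.isPreconnected
      (fun v hv => (hd v hv).differentiableAt.differentiableWithinAt)
      (fun v hv => (hd v hv).deriv) hw.2.2 hu₀
    linarith
  have hsol : ∀ u ∈ W, IsSolutionOn J U g C (fun s y => X.η (jetVec s y, u)) := fun u hu =>
    ⟨contDiffOn_slice hX.2 hu, fun t ht x hx => by
      have := zeroOrderCond_eq (C := C) hJ hU hW hg hX ht hx hu
      rw [(det (jetVec t x, u) (jetVec_mem_domain ht hx hu)).zero] at this
      exact this.symm⟩
  -- A second value of `u` in the open set `W` turns the slope of the affine `η` into a difference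
  -- quotient of two solutions.
  obtain ⟨u₁, hu₁, hne⟩ : ∃ u₁ ∈ W, u₁ - u₀ ≠ 0 := by
    obtain ⟨ε, hε, hball⟩ := Metric.isOpen_iff.1 hW u₀ hu₀
    refine ⟨u₀ + ε / 2, hball ?_, by simpa using hε.ne'⟩
    rw [Metric.mem_ball, Real.dist_eq, add_sub_cancel_left, abs_of_pos (half_pos hε)]
    exact half_lt_self hε
  let a : ℝ → (Fin n → ℝ) → ℝ := fun s y => ju X.η (jetVec s y, u₀)
  let b : ℝ → (Fin n → ℝ) → ℝ := fun s y => X.η (jetVec s y, u₀) - a s y * u₀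
  have ha : IsSolutionOn J U g C a :=
    ((hsol u₁ hu₁).lincomb hJ hU hg (hsol u₀ hu₀) (u₁ - u₀)⁻¹ (-(u₁ - u₀)⁻¹)).congr hJ hU hg
      fun s hs y hy => by
        rw [haff (z := jetVec s y) (u := u₁) (jetVec_mem_domain hs hy hu₁)]
        change ju X.η (jetVec s y, u₀) = _
        field_simp
        ring
  have hb : IsSolutionOn J U g C b :=
    ((hsol u₀ hu₀).lincomb hJ hU hg ha 1 (-u₀)).congr hJ hU hg fun s hs y hy => by
      change X.η (jetVec s y, u₀) - a s y * u₀ = _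
      ring
  -- The integrals vanish at `t₀`, so `c₁` is the value of `ξ^t` there. The choice `c₂ = 0` is
  -- possible because `a` is the full slope `η_{,u}`.
  refine ⟨X.ξ none (jetVec t₀ x₀, u₀), 0, T, a, b, hT, ha, hb, fun t ht x hx α => ?_,
    fun z u hw => ?_, hspace, fun z u hw => ?_⟩
  · rw [sum_lieCovector_sub hJ hU hW hX hT (fun I => (hY.homothetic I).smooth) hspace ht hx hu₀]
    have hpa : pd α (a t) x = jx (some α) (ju X.η) (jetVec t x, u₀) :=
      pd_slice hJ hU hW (contDiffOn_ju hΩ hX.2) ht hx hu₀ α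
    rw [hpa]
    exact (firstOrderCond_eq_zero_iff hJ hU hW hg hC hX ht hx hu₀
      (isHomotheticOn_space_slice hU hY.homothetic hspace ht hu₀)
      ((hτ' ht hx hu₀).trans (hfactor t ht))).1 (det (jetVec t x, u₀) (jetVec_mem_domain ht hx hu₀)).first α
  · have hd : ∀ t ∈ J, HasDerivAt (fun s => X.ξ none (jetVec s x₀, u₀)
        - 2 * ∑ I, ψ I * ∫ r in t₀..s, T I r) 0 t := by
      intro t ht
      have h1 := (hasDerivAt_time_slice hJ hU hW (hX.1 none) ht hx₀ hu₀).fun_sub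
        ((HasDerivAt.fun_sum (u := Finset.univ) fun I _ =>
          (hasDerivAt_integral_of_continuousOn hJ hJc ht₀ ht (hT I).continuousOn).const_mul
            (ψ I)).const_mul 2)
      rw [hfactor t ht] at h1
      simpa only [mul_comm (ψ _), sub_self] using h1
    have h1 := hJ.is_const_of_deriv_eq_zero hJc.isPreconnected
      (fun v hv => (hd v hv).differentiableAt.differentiableWithinAt)
      (fun v hv => (hd v hv).deriv) hw.1 ht₀
    have h2 := hτ (t := z none) (x := space z) (u := u) hw.1 hw.2.1 hw.2.2
    rw [jetVec_space] at h2
    simp only [intervalIntegral.integral_same, mul_zero, Finset.sum_const_zero, sub_zero] at h1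
    rw [h2]
    linarith
  · have e : jetVec (z none) (space z) = z := jetVec_space z
    rw [haff hw]
    simp only [a, b, e]
    ring

end Main

end PointSymmetry



theorem theorem1 {n : ℕ} (hn : 0 < n)
    (U : Set (Fin n → ℝ)) (hU : IsOpen U) (hUc : IsConnected U)
    (J W : Set ℝ) (hJ : IsOpen J) (hJc : J.OrdConnected)
    (hW : IsOpen W) (hWc : W.OrdConnected) (hWne : W.Nonempty)
    (t₀ : ℝ) (ht₀ : t₀ ∈ J)
    (g : (Fin n → ℝ) → Matrix (Fin n) (Fin n) ℝ) (hg : IsMetricOn U g)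
    (C : (Fin n → ℝ) → Fin n → ℝ) (hC : ContDiffOn ℝ ∞ C U) :
    (∃ (d : ℕ) (Y : Fin d → (Fin n → ℝ) → Fin n → ℝ) (ψ : Fin d → ℝ),
        IsHomotheticBasis U g Y ψ ∧ ∀ I, ψ I = 0 ∨ ψ I = 1) ∧
    ∀ (d : ℕ) (Y : Fin d → (Fin n → ℝ) → Fin n → ℝ) (ψ : Fin d → ℝ),
      IsHomotheticBasis U g Y ψ →
      ∀ X : PointField (Option (Fin n)), X.SmoothOn (domain J U W) →
        (IsLiePointSymmetry (evolutionTheta g C) (domain J U W) X ↔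
          ∃ (c₁ c₂ : ℝ) (T : Fin d → ℝ → ℝ) (a b : ℝ → (Fin n → ℝ) → ℝ),
            (∀ I, ContDiffOn ℝ ∞ (T I) J) ∧
            IsSolutionOn J U g C a ∧
            IsSolutionOn J U g C b ∧
            (∀ t ∈ J, ∀ x ∈ U, ∀ α,
              ∑ I, (T I t * lieCovector (Y I) (lower g C) x α
                - deriv (T I) t * lower g (Y I) x α) - 2 * pd α (a t) x = 0) ∧
            (∀ z u, (z, u) ∈ domain J U W →
              X.ξ none (z, u) = c₁ + 2 * ∑ I, ψ I * ∫ t in t₀..(z none), T I t) ∧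
            (∀ z u, (z, u) ∈ domain J U W → ∀ α,
              X.ξ (some α) (z, u) = ∑ I, T I (z none) * Y I (space z) α) ∧
            (∀ z u, (z, u) ∈ domain J U W →
              X.η (z, u) = (a (z none) (space z) + c₂) * u + b (z none) (space z))) := by
  refine ⟨exists_isHomotheticBasis hn hU hUc hg, fun d Y ψ hY X hX => ⟨fun h => ?_, ?_⟩⟩
  · obtain ⟨c₁, c₂, T, a, b, hT, ha, hb, hlie, htime, hspace, heta⟩ :=
      h.exists_isSymmetryForm hn hU hUc hJ hJc hW hWc hWne ht₀ hg hC hY hX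
    exact ⟨c₁, c₂, T, a, b, hT, ha, hb, hlie, htime, hspace, heta⟩
  · rintro ⟨c₁, c₂, T, a, b, hT, ha, hb, hlie, htime, hspace, heta⟩
    exact IsSymmetryForm.isLiePointSymmetry hU hJ hJc hW ht₀ hg hC hY.homothetic hX
      ⟨hT, ha, hb, hlie, htime, hspace, heta⟩
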